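/- Let $k,m,N$ be positive integers with $m$ square-free and let $\chi$ be a Dirichlet character modulo $mN$. Write $\theta^J_{m,r}(\tau,z)=\sum_{n\in\mathbb Z}e^{2\pi i m((n+\frac r{2m})^2\tau+2(n+\frac r{2m})z)}$ and $\theta_{m,r}(\tau)=\theta^J_{m,r}(\tau,0)$ for $\tau\in\mathbb H$, $z\in\mathbb C$, $0\le r<2m$. For $\gamma=\begin{pmatrix}a&b\\c&d\end{pmatrix}\in SL_2(\mathbb Z)$ let $U_1(\gamma)$ be the $2\times 2$ matrix such that $\Theta(\gamma\tau,\tfrac{z}{c\tau+d})=e^{2\pi i\frac{cz^2}{c\tau+d}}(c\tau+d)^{1/2}U_1(\gamma)\Theta(\tau,z)$ (principal square root) for the column vector $\Theta=(\theta^J_{1,0},\theta^J_{1,1})^t$, and for $\gamma\in\Gamma_0(m)$ put $\omega_m(\gamma)=\det U_1\begin{pmatrix}a&mb\\c/m&d\end{pmatrix}$. Let $M_w(\Gamma_0(mN),v)$ and $S_w(\Gamma_0(mN),v)$ be the spaces of modular forms and of cusp forms of weight $w$ on $\Gamma_0(mN)$ with character $v$; $\chi$ is viewed as the character $\gamma\mapsto\chi(d)$.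 Let $J_{k,m}(\Gamma_0(mN),\chi)$ be the space of Jacobi forms $\phi(\tau,z)$ of weight $k$, index $m$ and character $\chi$ for $\Gamma_0(mN)\ltimes\mathbb Z^2$, with theta decomposition $\phi=\sum_{0\le r<2m}h_{m,r}(\tau)\theta^J_{m,r}(\tau,z)$, and let $J^*_{k,m}(\Gamma_0(mN),\chi)^0$ be the subspace of those $\phi$ with $h_{m,r}=0$ for all $r\ne 0,m$ and $\phi(\tau,0)=0$. Put $\xi^*_m=\theta_{m,m}\theta_{m,0}'-\theta_{m,0}\theta_{m,m}'$, let $$S^*_{k+2}(\Gamma_0(mN),\chi)^0=\{f\in S_{k+2}(\Gamma_0(mN),\chi): f/\xi^*_m\in M_{k-1}(\Gamma_0(mN),\chi\overline{\omega}_m)\},$$ and let $D_2=\left(\frac{k}{2\pi i}\frac{\partial^2}{\partial z^2}-2m\frac{\partial}{\partial\tau}\right)\Big|_{z=0}$. Then: 1. $\xi^*_m(\tau)=-\pi i\,m\,\eta(m\tau)^6$ for all $\tau\in\mathbb H$, where $\eta$ is the Dedekind eta function. 2. $D_2$ is a linear map from $J_{k,m}(\Gamma_0(mN),\chi)$ to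 $S_{k+2}(\Gamma_0(mN),\chi)$. On $J^*_{k,m}(\Gamma_0(mN),\chi)^0$ it agrees with $\left(\frac{k}{2\pi i}\frac{\partial^2}{\partial z^2}-a\frac{\partial}{\partial\tau}\right)\Big|_{z=0}$ for every $a\in\mathbb C$. 3. $D_2$ restricts to a linear isomorphism $J^*_{k,m}(\Gamma_0(mN),\chi)^0\to S^*_{k+2}(\Gamma_0(mN),\chi)^0$. 4. The map $\Lambda^*_m:\phi\mapsto\frac{h_{m,0}}{\theta_{m,m}}=-\frac{h_{m,m}}{\theta_{m,0}}$ is a linear isomorphism $J^*_{k,m}(\Gamma_0(mN),\chi)^0\to M_{k-1}(\Gamma_0(mN),\chi\overline{\omega}_m)$, the map $\varphi\mapsto 4mk\,\xi^*_m\varphi$ is a linear isomorphism $M_{k-1}(\Gamma_0(mN),\chi\overline{\omega}_m)\to S^*_{k+2}(\Gamma_0(mN),\chi)^0$, and its composition with $\Lambda^*_m$ is $D_2$ on $J^*_{k,m}(\Gamma_0(mN),\chi)^0$. -/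

import Mathlib

open UpperHalfPlane hiding I
open Complex MatrixGroups CongruenceSubgroup ModularForm Manifold
open scoped Real

noncomputable section

namespace JacobiRestriction

/-- The automorphy factor `c τ + d`. -/
def autFactor (γ : SL(2, ℤ)) (τ : ℍ) : ℂ := (γ 1 0 : ℂ) * (τ : ℂ) + (γ 1 1 : ℂ)

/-! ### Theta functions and the theta multiplier -/

/-- The Jacobi theta series
`θ^J_{m,r}(τ,z) = ∑_{n ∈ ℤ} exp (2πi m ((n + r/2m)² τ + 2 (n + r/2m) z))`. -/
def thetaJ (m r : ℕ) (τ z : ℂ) : ℂ :=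
  ∑' n : ℤ, cexp (2 * π * I * m *
    (((n : ℂ) + (r : ℂ) / (2 * m)) ^ 2 * τ + 2 * ((n : ℂ) + (r : ℂ) / (2 * m)) * z))

/-- The theta constant `θ_{m,r}(τ) = θ^J_{m,r}(τ,0)`. -/
def theta (m r : ℕ) (τ : ℂ) : ℂ := thetaJ m r τ 0

/-- `U` is the matrix of the transformation law of the column vector `(θ^J_{m,r})_{0 ≤ r < 2m}`
under `γ`:
`Θ^J(γ(τ,z)) = exp (2πi m c z² / (cτ+d)) (cτ+d)^{1/2} U Θ^J(τ,z)` (principal square root). -/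
def IsThetaMultiplier (m : ℕ) (γ : SL(2, ℤ)) (U : Matrix (Fin (2 * m)) (Fin (2 * m)) ℂ) : Prop :=
  ∀ (τ : ℍ) (z : ℂ) (r : Fin (2 * m)),
    thetaJ m r ((γ • τ : ℍ) : ℂ) (z / autFactor γ τ) =
      cexp (2 * π * I * m * ((γ 1 0 : ℂ) * z ^ 2 / autFactor γ τ)) *
        autFactor γ τ ^ (1 / 2 : ℂ) * ∑ s : Fin (2 * m), U r s * thetaJ m s (τ : ℂ) z

/-- The matrix `U_m(γ)` of the transformation law of the theta vector. It exists, and it is unique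
because the functions `θ^J_{m,r}` with `0 ≤ r < 2m` are linearly independent. -/
def thetaMultiplier (m : ℕ) (γ : SL(2, ℤ)) : Matrix (Fin (2 * m)) (Fin (2 * m)) ℂ :=
  Classical.epsilon (IsThetaMultiplier m γ)

/-- For `γ = (a, b; c, d) ∈ Γ₀(m)`, the matrix `γ_m = (a, bm; c/m, d) ∈ SL₂(ℤ)`. -/
def conjLevel (m : ℕ) (γ : Gamma0 m) : SL(2, ℤ) :=
  ⟨!![γ.1 0 0, γ.1 0 1 * m; γ.1 1 0 / m, γ.1 1 1], by
    have hdvd : (m : ℤ) ∣ γ.1 1 0 :=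
      (ZMod.intCast_zmod_eq_zero_iff_dvd _ m).1 (Gamma0_mem.1 γ.2)
    have hdet := γ.1.det_coe
    rw [Matrix.det_fin_two] at hdet
    rw [Matrix.det_fin_two_of, mul_assoc, Int.mul_ediv_cancel' hdvd, hdet]⟩

/-- The character `ω_m(γ) = det U_1(γ_m)` of `Γ₀(m)`. -/
def omega (m : ℕ) (γ : Gamma0 m) : ℂ := (thetaMultiplier 1 (conjLevel m γ)).det

/-- `ξ*_m = θ_{m,m} θ_{m,0}' - θ_{m,0} θ_{m,m}'`. -/
def xiStar (m : ℕ) (τ : ℍ) : ℂ :=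
  theta m m τ * deriv (theta m 0) τ - theta m 0 τ * deriv (theta m m) τ

/-! ### Modular forms and cusp forms on `Γ₀(N)` with a multiplier -/

/-- The space of modular forms of weight `k` on `Γ₀(N)` with character `v`: holomorphic functions
`f` on `ℍ` with `f(γτ) = v(γ) (cτ+d)^k f(τ)` for `γ ∈ Γ₀(N)` that are holomorphic at the cusps. -/
def modularForms (k : ℤ) (N : ℕ) (v : Gamma0 N → ℂ) : Submodule ℂ (ℍ → ℂ) where
  carrier := {f | MDiff f ∧
    (∀ (γ : Gamma0 N) (τ : ℍ), f (γ.1 • τ) = v γ * autFactor γ.1 τ ^ k * f τ) ∧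
    ∀ g : SL(2, ℤ), IsBoundedAtImInfty (f ∣[k] g)}
  zero_mem' := by
    refine ⟨mdifferentiable_const, by simp, fun g ↦ ?_⟩
    rw [SlashAction.zero_slash]
    exact (zero_form_isBoundedAtImInfty)
  add_mem' := by
    rintro f g ⟨hf1, hf2, hf3⟩ ⟨hg1, hg2, hg3⟩
    refine ⟨hf1.add hg1, fun γ τ ↦ ?_, fun γ ↦ ?_⟩
    · simp only [Pi.add_apply, hf2 γ τ, hg2 γ τ]
      ring
    · rw [SlashAction.add_slash]
      exact (hf3 γ).add (hg3 γ)
  smul_mem' := by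
    rintro c f ⟨hf1, hf2, hf3⟩
    refine ⟨hf1.const_smul c, fun γ τ ↦ ?_, fun γ ↦ ?_⟩
    · simp only [Pi.smul_apply, hf2 γ τ, smul_eq_mul]
      ring
    · rw [ModularForm.SL_smul_slash]
      exact (hf3 γ).smul c

/-- The subspace of cusp forms: modular forms that vanish at all cusps. -/
def cuspForms (k : ℤ) (N : ℕ) (v : Gamma0 N → ℂ) : Submodule ℂ (ℍ → ℂ) where
  carrier := {f | f ∈ modularForms k N v ∧ ∀ g : SL(2, ℤ), IsZeroAtImInfty (f ∣[k] g)}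
  zero_mem' := by
    refine ⟨zero_mem _, fun g ↦ ?_⟩
    rw [SlashAction.zero_slash]
    exact Filter.zero_zeroAtFilter _
  add_mem' := by
    rintro f g ⟨hf1, hf2⟩ ⟨hg1, hg2⟩
    refine ⟨add_mem hf1 hg1, fun γ ↦ ?_⟩
    rw [SlashAction.add_slash]
    exact (hf2 γ).add (hg2 γ)
  smul_mem' := by
    rintro c f ⟨hf1, hf2⟩
    refine ⟨Submodule.smul_mem _ c hf1, fun γ ↦ ?_⟩
    rw [ModularForm.SL_smul_slash]
    exact (hf2 γ).smul c

/-- The character `γ = (a, b; c, d) ↦ χ(d)` of `Γ₀(N)`. -/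
def nebentypus {N : ℕ} (χ : DirichletCharacter ℂ N) (γ : Gamma0 N) : ℂ := χ ((γ.1 1 1 : ℤ) : ZMod N)

lemma Gamma0_mul_le (m N : ℕ) : Gamma0 (m * N) ≤ Gamma0 m := fun γ hγ ↦ by
  rw [Gamma0_mem, ZMod.intCast_zmod_eq_zero_iff_dvd] at *
  exact dvd_trans ⟨(N : ℤ), by push_cast; ring⟩ hγ

/-- The character `χ ω̄_m` of `Γ₀(mN)`. -/
def twistedNebentypus (m : ℕ) {N : ℕ} (χ : DirichletCharacter ℂ (m * N)) (γ : Gamma0 (m * N)) : ℂ :=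
  nebentypus χ γ * starRingEnd ℂ (omega m ⟨γ.1, Gamma0_mul_le m N γ.2⟩)

/-! ### Jacobi forms -/

/-- `(φ|_{k,m} g)(τ,z) = (cτ+d)^{-k} exp (-2πi m c z² / (cτ+d)) φ(g(τ,z))`. -/
def jacobiSlash (k : ℤ) (m : ℕ) (g : SL(2, ℤ)) (φ : ℍ → ℂ → ℂ) (τ : ℍ) (z : ℂ) : ℂ :=
  autFactor g τ ^ (-k) * cexp (-(2 * π * I * m * ((g 1 0 : ℂ) * z ^ 2 / autFactor g τ))) *
    φ (g • τ) (z / autFactor g τ)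

/-- `φ` has a Fourier expansion `∑ c(n,r) q^{n/N} ζ^r` over integers `n`, `r`, where `c(n,r) = 0`
unless `r² ≤ 4 m (n/N)`. -/
def HasJacobiExpansion (m N : ℕ) (φ : ℍ → ℂ → ℂ) : Prop :=
  ∃ c : ℤ → ℤ → ℂ, (∀ n r : ℤ, 4 * m * n < N * r ^ 2 → c n r = 0) ∧
    ∀ (τ : ℍ) (z : ℂ),
      HasSum (fun p : ℤ × ℤ ↦ c p.1 p.2 * cexp (2 * π * I * (p.1 * (τ : ℂ) / N + p.2 * z))) (φ τ z)

/-- The space `J_{k,m}(Γ₀(N), χ)` of Jacobi forms of weight `k`, index `m` and character `χ` for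
the Jacobi group `Γ₀(N) ⋉ ℤ²`. -/
def jacobiForms (k : ℤ) (m N : ℕ) (χ : DirichletCharacter ℂ N) : Submodule ℂ (ℍ → ℂ → ℂ) where
  carrier := {φ |
    DifferentiableOn ℂ (fun p : ℂ × ℂ ↦ φ (ofComplex p.1) p.2) {p | 0 < p.1.im} ∧
    (∀ (γ : Gamma0 N) (τ : ℍ) (z : ℂ), φ (γ.1 • τ) (z / autFactor γ.1 τ) =
      nebentypus χ γ * autFactor γ.1 τ ^ k *
        cexp (2 * π * I * m * ((γ.1 1 0 : ℂ) * z ^ 2 / autFactor γ.1 τ)) * φ τ z) ∧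
    (∀ (l μ : ℤ) (τ : ℍ) (z : ℂ), φ τ (z + l * τ + μ) =
      cexp (-(2 * π * I * m * ((l : ℂ) ^ 2 * τ + 2 * l * z))) * φ τ z) ∧
    ∀ g : SL(2, ℤ), HasJacobiExpansion m N (jacobiSlash k m g φ)}
  zero_mem' := by
    refine ⟨differentiableOn_const 0, by simp, by simp, fun g ↦ ⟨0, by simp, fun τ z ↦ ?_⟩⟩
    simp [jacobiSlash, hasSum_zero]
  add_mem' := by
    rintro φ ψ ⟨h1, h2, h3, h4⟩ ⟨h1', h2', h3', h4'⟩
    refine ⟨h1.add h1', fun γ τ z ↦ ?_, fun l μ τ z ↦ ?_, fun g ↦ ?_⟩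
    · simp only [Pi.add_apply, h2, h2']
      ring
    · simp only [Pi.add_apply, h3, h3']
      ring
    · obtain ⟨c, hc, hs⟩ := h4 g
      obtain ⟨c', hc', hs'⟩ := h4' g
      refine ⟨c + c', fun n r h ↦ by simp [hc n r h, hc' n r h], fun τ z ↦ ?_⟩
      convert (hs τ z).add (hs' τ z) using 1
      · ext p
        simp only [Pi.add_apply]
        ring
      · simp only [jacobiSlash, Pi.add_apply]
        ring
  smul_mem' := by
    rintro a φ ⟨h1, h2, h3, h4⟩
    refine ⟨h1.const_smul a, fun γ τ z ↦ ?_, fun l μ τ z ↦ ?_, fun g ↦ ?_⟩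
    · simp only [Pi.smul_apply, smul_eq_mul, h2]
      ring
    · simp only [Pi.smul_apply, smul_eq_mul, h3]
      ring
    · obtain ⟨c, hc, hs⟩ := h4 g
      refine ⟨a • c, fun n r h ↦ by simp [hc n r h], fun τ z ↦ ?_⟩
      have e : jacobiSlash k m g (a • φ) τ z = a * jacobiSlash k m g φ τ z := by
        simp only [jacobiSlash, Pi.smul_apply, smul_eq_mul]
        ring
      rw [e]
      simpa [mul_assoc] using (hs τ z).mul_left a

/-- The functions `h_{m,r}` with `0 ≤ r < 2m` are the components of the theta decomposition
`φ = ∑_{0 ≤ r < 2m} h_{m,r} θ^J_{m,r}`. -/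
def IsThetaDecomposition (m : ℕ) (φ : ℍ → ℂ → ℂ) (h : ℕ → ℍ → ℂ) : Prop :=
  ∀ (τ : ℍ) (z : ℂ), φ τ z = ∑ r ∈ Finset.range (2 * m), h r τ * thetaJ m r τ z

/-- The space `J*_{k,m}(Γ₀(mN), χ)⁰` of the Jacobi forms whose theta components `h_{m,r}` vanish
for all `r ≠ 0, m` and whose restriction to `z = 0` vanishes. -/
def jacobiStarKernel (k : ℤ) (m N : ℕ) (χ : DirichletCharacter ℂ (m * N)) :
    Submodule ℂ (ℍ → ℂ → ℂ) where
  carrier := {φ | φ ∈ jacobiForms k m (m * N) χ ∧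
    (∃ h : ℕ → ℍ → ℂ, IsThetaDecomposition m φ h ∧
      ∀ r < 2 * m, r ≠ 0 → r ≠ m → h r = 0) ∧
    ∀ τ : ℍ, φ τ 0 = 0}
  zero_mem' := ⟨zero_mem _, ⟨0, by simp [IsThetaDecomposition], by simp⟩, by simp⟩
  add_mem' := by
    rintro φ ψ ⟨h1, ⟨h, hd, hv⟩, h3⟩ ⟨h1', ⟨h', hd', hv'⟩, h3'⟩
    refine ⟨add_mem h1 h1', ⟨h + h', fun τ z ↦ ?_, fun r a b c ↦ ?_⟩, fun τ ↦ ?_⟩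
    · simp [hd τ z, hd' τ z, add_mul, Finset.sum_add_distrib]
    · simp [hv r a b c, hv' r a b c]
    · simp [h3, h3']
  smul_mem' := by
    rintro a φ ⟨h1, ⟨h, hd, hv⟩, h3⟩
    refine ⟨Submodule.smul_mem _ a h1, ⟨a • h, fun τ z ↦ ?_, fun r a b c ↦ ?_⟩, fun τ ↦ ?_⟩
    · simp [hd τ z, Finset.mul_sum, mul_assoc]
    · simp [hv r a b c]
    · simp [h3]

/-- The operator `((k/2πi) ∂²/∂z² - a ∂/∂τ)|_{z=0}`. -/
def heatOperator (k : ℕ) (a : ℂ) (φ : ℍ → ℂ → ℂ) (τ : ℍ) : ℂ :=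
  (k : ℂ) / (2 * π * I) * iteratedDeriv 2 (fun z : ℂ ↦ φ τ z) 0 -
    a * deriv (fun w : ℂ ↦ φ (ofComplex w) 0) (τ : ℂ)

/-- The operator `D₂ = ((k/2πi) ∂²/∂z² - 2m ∂/∂τ)|_{z=0}` on functions of index `m`. -/
def D₂ (k m : ℕ) (φ : ℍ → ℂ → ℂ) : ℍ → ℂ := heatOperator k (2 * m) φ

/-- The space `S*_{k+2}(Γ₀(mN), χ)⁰` of the cusp forms `f` of weight `k + 2` with
`f / ξ*_m ∈ M_{k-1}(Γ₀(mN), χ ω̄_m)`. -/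
def cuspStar (k : ℤ) (m N : ℕ) (χ : DirichletCharacter ℂ (m * N)) : Submodule ℂ (ℍ → ℂ) where
  carrier := {f | f ∈ cuspForms (k + 2) (m * N) (nebentypus χ) ∧
    f / xiStar m ∈ modularForms (k - 1) (m * N) (twistedNebentypus m χ)}
  zero_mem' := ⟨zero_mem _, by 
    convert zero_mem (modularForms (k - 1) (m * N) (twistedNebentypus m χ)) using 1
    ext τ
    simp⟩
  add_mem' := by
    rintro f g ⟨h1, h2⟩ ⟨h1', h2'⟩
    exact ⟨add_mem h1 h1', by
      convert add_mem h2 h2' using 1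
      ext τ
      simp [add_div]⟩
  smul_mem' := by
    rintro a f ⟨h1, h2⟩
    exact ⟨Submodule.smul_mem _ a h1, by
      convert Submodule.smul_mem _ a h2 using 1
      ext τ
      simp [mul_div_assoc]⟩

end JacobiRestriction

end

open JacobiRestriction

/-!
By the theta decomposition, a Jacobi form in `jacobiStarKernel` is exactly a product of some
function `f` on `ℍ` with the wedge `θ_{m,m} θ^J_{m,0} - θ_{m,0} θ^J_{m,m}`. This wedge is the
index-one wedge at `(mτ, mz)`, on which `SL(2, ℤ)` acts through the determinant of the theta
multiplier; hence the character `ω_m`. By the heat equation its second `z`-derivative at `z = 0` is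
a multiple of `ξ*_m`, so that `D₂` becomes `f ↦ 4 m k ξ*_m f`.

Both `ξ*_1` and `θ_{1,0} θ_{1,1} (θ_{1,0}⁴ - θ_{1,1}⁴)` transform like `η⁶`. Their quotients by
`η⁶` are bounded modular functions of level one, hence constant; therefore `ξ*_m` and the theta
constants have no zeros, and `f` can be recovered from `D₂`. At a cusp, the factorization
`diag(m, 1) g = g' (a, b; 0, d)` turns the wedge at `m (g τ)` into the one at `(a τ + b) / d`, and
comparing Fourier coefficients in `z` shows that `f` is holomorphic at the cusp if and only if the
Jacobi form is.
-/

noncomputable section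

open Filter Topology

namespace JacobiRestriction

/-! ### Exponential series -/

section ExponentialSeries

variable {ι : Type*} {c : ι → ℂ} {y : ι → ℝ}

lemma norm_cexp_I_mul (y : ℝ) (w : ℂ) : ‖cexp (I * y * w)‖ = Real.exp (-(y * w.im)) := by
  rw [Complex.norm_exp]
  simp

lemma norm_mul_cexp_le (hy : ∀ i, c i ≠ 0 → 0 ≤ y i) {t : ℝ} {w : ℂ} (hw : t ≤ w.im) (i : ι) :
    ‖c i * cexp (I * y i * w)‖ ≤ ‖c i * cexp (I * y i * (t * I))‖ := by
  rcases eq_or_ne (c i) 0 with h | h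
  · simp [h]
  · rw [norm_mul, norm_mul, norm_cexp_I_mul, norm_cexp_I_mul]
    gcongr
    · exact hy i h
    · simpa using hw

theorem differentiableOn_tsum_cexp (hy : ∀ i, c i ≠ 0 → 0 ≤ y i)
    (hs : ∀ w : ℂ, 0 < w.im → Summable fun i ↦ c i * cexp (I * y i * w)) :
    DifferentiableOn ℂ (fun w ↦ ∑' i, c i * cexp (I * y i * w)) {w | 0 < w.im} := by
  intro w hw
  obtain ⟨t, ht, htw⟩ := exists_between (show 0 < w.im from hw)
  have hU : IsOpen {w : ℂ | t < w.im} := isOpen_lt continuous_const continuous_im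
  refine ((differentiableOn_tsum_of_summable_norm (hs (t * I) (by simpa using ht)).norm
    (fun i ↦ ?_) hU fun i w hw ↦ norm_mul_cexp_le hy (le_of_lt hw) i).differentiableAt
      (hU.mem_nhds htw)).differentiableWithinAt
  exact (Differentiable.differentiableOn (by fun_prop))

theorem hasSum_deriv_tsum_cexp (hy : ∀ i, c i ≠ 0 → 0 ≤ y i)
    (hs : ∀ w : ℂ, 0 < w.im → Summable fun i ↦ c i * cexp (I * y i * w)) {w : ℂ} (hw : 0 < w.im) :
    HasSum (fun i ↦ c i * (I * y i) * cexp (I * y i * w))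
      (deriv (fun w ↦ ∑' i, c i * cexp (I * y i * w)) w) := by
  obtain ⟨t, ht, htw⟩ := exists_between hw
  have hU : IsOpen {w : ℂ | t < w.im} := isOpen_lt continuous_const continuous_im
  have := hasSum_deriv_of_summable_norm (hs (t * I) (by simpa using ht)).norm
    (fun i ↦ Differentiable.differentiableOn (by fun_prop)) hU
      (fun i w hw ↦ norm_mul_cexp_le hy (le_of_lt hw) i) htw
  convert! this using 2 with i
  have h : HasDerivAt (fun w : ℂ ↦ c i * cexp (I * y i * w))
      (c i * (cexp (I * y i * w) * (I * y i * 1))) w :=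
    (((hasDerivAt_id w).const_mul (I * (y i : ℂ))).cexp).const_mul (c i)
  rw [h.deriv]
  ring

theorem exists_norm_le_of_hasSum_cexp {δ : ℝ} (hy : ∀ i, c i ≠ 0 → δ ≤ y i)
    (hs : Summable fun i ↦ c i * cexp (I * y i * I)) :
    ∃ C, ∀ (w S : ℂ), 1 ≤ w.im → HasSum (fun i ↦ c i * cexp (I * y i * w)) S →
      ‖S‖ ≤ C * Real.exp (-(δ * w.im)) := by
  refine ⟨(∑' i, ‖c i * cexp (I * y i * I)‖) * Real.exp δ, fun w S hw hS ↦ ?_⟩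
  rw [mul_assoc, ← Real.exp_add, ← hS.tsum_eq, ← tsum_mul_right]
  refine tsum_of_norm_bounded (hs.norm.mul_right _).hasSum fun i ↦ ?_
  rcases eq_or_ne (c i) 0 with h | h
  · simp [h]
  · rw [norm_mul, norm_mul, norm_cexp_I_mul, norm_cexp_I_mul, mul_assoc, ← Real.exp_add]
    gcongr
    have := hy i h
    rw [Complex.I_im]
    nlinarith

theorem tendsto_atImInfty_of_hasSum_cexp {G : ℍ → ℂ} {δ : ℝ} (hδ : 0 < δ) (s : Finset ι)
    (hG : ∀ τ : ℍ, HasSum (fun i ↦ c i * cexp (I * y i * τ)) (G τ))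
    (h0 : ∀ i ∈ s, y i = 0) (hy : ∀ i, i ∉ s → c i ≠ 0 → δ ≤ y i) :
    Tendsto G atImInfty (𝓝 (∑ i ∈ s, c i)) := by
  classical
  let c' : ι → ℂ := fun i ↦ if i ∈ s then 0 else c i
  have hG' (τ : ℍ) : HasSum (fun i ↦ c' i * cexp (I * y i * τ)) (G τ - ∑ i ∈ s, c i) := by
    have h2 : HasSum (fun i ↦ if i ∈ s then c i else 0) (∑ i ∈ s, c i) := by
      have : HasSum (fun i ↦ if i ∈ s then c i else 0) (∑ i ∈ s, if i ∈ s then c i else 0) :=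
        hasSum_sum_of_ne_finset_zero fun i hi ↦ if_neg hi
      rwa [Finset.sum_congr rfl fun i hi ↦ if_pos hi] at this
    convert! (hG τ).sub h2 using 2 with i
    by_cases hi : i ∈ s <;> simp [c', hi, h0]
  obtain ⟨C, hC⟩ := exists_norm_le_of_hasSum_cexp (c := c') (y := y) (δ := δ)
    (fun i hi ↦ hy i (by grind) (by grind)) (by simpa using (hG' UpperHalfPlane.I).summable)
  rw [tendsto_iff_norm_sub_tendsto_zero]
  have hlim : Tendsto (fun τ : ℍ ↦ C * Real.exp (-(δ * τ.im))) atImInfty (𝓝 0) := by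
    rw [← mul_zero C]
    refine (Real.tendsto_exp_neg_atTop_nhds_zero.comp
      (Tendsto.const_mul_atTop hδ tendsto_comap)).const_mul C
  refine squeeze_zero' (.of_forall fun _ ↦ norm_nonneg _) ?_ hlim
  have hev : ∀ᶠ τ : ℍ in atImInfty, 1 ≤ τ.im := tendsto_comap.eventually_ge_atTop 1
  filter_upwards [hev] with τ hτ
  exact hC τ _ hτ (hG' τ)

theorem hasSum_iteratedDeriv_of_summable_norm {E : Type*} [NormedAddCommGroup E] [NormedSpace ℂ E]
    [CompleteSpace E] {f : ι → ℂ → E} {u : ι → ℝ} {U : Set ℂ} {z : ℂ} (hu : Summable u)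
    (hf : ∀ i, DifferentiableOn ℂ (f i) U) (hU : IsOpen U) (hle : ∀ i, ∀ w ∈ U, ‖f i w‖ ≤ u i)
    (hz : z ∈ U) (n : ℕ) :
    HasSum (fun i ↦ iteratedDeriv n (f i) z) (iteratedDeriv n (fun w ↦ ∑' i, f i w) z) := by
  have hdiff (s : Finset ι) : DifferentiableOn ℂ (fun w ↦ ∑ i ∈ s, f i w) U :=
    .fun_sum fun i _ ↦ hf i
  have hlim : TendstoLocallyUniformlyOn
      (fun s : Finset ι ↦ iteratedDeriv n fun w ↦ ∑ i ∈ s, f i w)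
      (iteratedDeriv n fun w ↦ ∑' i, f i w) atTop U := by
    induction n with
    | zero =>
      simpa only [iteratedDeriv_zero] using
        (tendstoUniformlyOn_tsum hu hle).tendstoLocallyUniformlyOn
    | succ n ih =>
      simp only [iteratedDeriv_succ]
      refine ih.deriv (.of_forall fun s ↦ ?_) hU
      rw [iteratedDeriv_eq_iterate]
      exact (((hdiff s).analyticOnNhd hU).iterated_deriv n).differentiableOn
  refine (hlim.tendsto_at hz).congr fun s ↦ iteratedDeriv_fun_sum fun i _ ↦ ?_
  exact ((hf i).contDiffOn hU).contDiffAt (hU.mem_nhds hz)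

theorem hasSum_iteratedDeriv_tsum_cexp {x : ι → ℝ}
    (hs : ∀ z : ℂ, Summable fun i ↦ c i * cexp (I * x i * z)) (n : ℕ) :
    HasSum (fun i ↦ c i * (I * x i) ^ n)
      (iteratedDeriv n (fun z ↦ ∑' i, c i * cexp (I * x i * z)) 0) := by
  have hsum : Summable fun i ↦ ‖c i‖ * Real.exp |x i| := by
    refine .of_nonneg_of_le (fun i ↦ by positivity) (fun i ↦ ?_) ((hs I).norm.add (hs (-I)).norm)
    rw [norm_mul, norm_mul, norm_cexp_I_mul, norm_cexp_I_mul, ← mul_add]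
    gcongr
    simpa [add_comm] using Real.exp_abs_le (x i)
  have hle (i : ι) (w : ℂ) (hw : w ∈ Metric.ball (0 : ℂ) 1) :
      ‖c i * cexp (I * x i * w)‖ ≤ ‖c i‖ * Real.exp |x i| := by
    have hw' : ‖w‖ ≤ 1 := (mem_ball_zero_iff.1 hw).le
    rw [norm_mul, norm_cexp_I_mul]
    gcongr
    calc -(x i * w.im) ≤ |x i| * |w.im| := by rw [← abs_mul]; exact neg_le_abs _
      _ ≤ |x i| := mul_le_of_le_one_right (abs_nonneg _) ((abs_im_le_norm w).trans hw')
  convert! hasSum_iteratedDeriv_of_summable_norm hsum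
    (fun i ↦ Differentiable.differentiableOn (by fun_prop)) Metric.isOpen_ball hle
    (Metric.mem_ball_self one_pos) n using 2 with i
  rw [iteratedDeriv_const_mul_field, iteratedDeriv_cexp_const_mul]
  simp

end ExponentialSeries

/-! ### Fourier coefficients of `1`-periodic functions -/

/-- The coefficient of `exp (2πi a z)` in the Fourier expansion of `F`. -/
def fourierMode (a : ℤ) (F : ℂ → ℂ) : ℂ := ∫ t in (0 : ℝ)..1, F t * cexp (-(2 * π * I * (a * t)))

lemma fourierMode_const_mul (a : ℤ) (b : ℂ) (F : ℂ → ℂ) :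
    fourierMode a (fun z ↦ b * F z) = b * fourierMode a F := by
  simp [fourierMode, mul_assoc]

lemma integral_cexp_two_pi_I (n : ℤ) :
    ∫ t in (0 : ℝ)..1, cexp (2 * π * I * (n * t)) = if n = 0 then 1 else 0 := by
  split_ifs with h
  · simp [h]
  · have hc : (2 * π * I * n : ℂ) ≠ 0 := mul_ne_zero two_pi_I_ne_zero (mod_cast h)
    have := integral_exp_mul_complex (a := 0) (b := 1) hc
    simp only [mul_assoc] at this ⊢
    rw [this]
    have e : cexp (2 * (π * (I * (n * (1 : ℝ))))) = 1 := by
      rw [Complex.exp_eq_one_iff]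
      exact ⟨n, by push_cast; ring⟩
    rw [e]
    simp

theorem hasSum_fourierMode {ι : Type*} [Countable ι] {A : ι → ℂ} {r : ι → ℤ} {F : ℂ → ℂ}
    (hF : ∀ t : ℝ, HasSum (fun i ↦ A i * cexp (2 * π * I * (r i * (t : ℂ)))) (F t)) (a : ℤ) :
    HasSum (fun i ↦ if r i = a then A i else 0) (fourierMode a F) := by
  let f : ι → C(ℝ, ℂ) := fun i ↦ ⟨fun t ↦ A i * cexp (2 * π * I * ((r i - a : ℤ) * (t : ℂ))), by
    fun_prop⟩
  have hA : Summable fun i ↦ ‖A i‖ := by simpa using (hF 0).summable.norm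
  have hle (i : ι) : ‖(f i).restrict (⟨Set.uIcc 0 1, isCompact_uIcc⟩ :
      TopologicalSpace.Compacts ℝ)‖ ≤ ‖A i‖ := by
    refine (ContinuousMap.norm_le _ (norm_nonneg _)).2 fun t ↦ ?_
    have e : (2 * π * I * ((r i - a : ℤ) * ((t : ℝ) : ℂ))) =
      ((2 * π * (r i - a : ℤ) * t : ℝ) : ℂ) * I := by push_cast; ring
    simp only [f, ContinuousMap.restrict_apply, ContinuousMap.coe_mk]
    rw [norm_mul, e, norm_exp_ofReal_mul_I, mul_one]
  have h := intervalIntegral.hasSum_intervalIntegral_of_summable_norm (a := 0) (b := 1) (f := f)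
    (.of_nonneg_of_le (fun _ ↦ norm_nonneg _) hle hA)
  have hfun (t : ℝ) : ∑' i, f i t = F t * cexp (-(2 * π * I * (a * t))) := by
    rw [← (hF t).tsum_eq, ← tsum_mul_right]
    refine tsum_congr fun i ↦ ?_
    simp only [f, ContinuousMap.coe_mk]
    conv_rhs => rw [mul_assoc (A i), ← Complex.exp_add]
    push_cast
    ring_nf
  simp only [hfun] at h
  refine h.congr_fun fun i ↦ ?_
  simp only [f, ContinuousMap.coe_mk, intervalIntegral.integral_const_mul,
    integral_cexp_two_pi_I, sub_eq_zero]
  split_ifs <;> simp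

/-! ### The theta series -/

section Theta

variable {m r : ℕ} {τ z : ℂ}

lemma thetaJ_term_eq (hm : m ≠ 0) (r : ℕ) (τ z : ℂ) (n : ℤ) :
    cexp (2 * π * I * m * (((n : ℂ) + (r : ℂ) / (2 * m)) ^ 2 * τ +
      2 * ((n : ℂ) + (r : ℂ) / (2 * m)) * z)) =
    cexp (2 * π * I * (r ^ 2 * τ / (4 * m) + r * z)) *
      jacobiTheta₂_term n (r * τ + 2 * m * z) (2 * m * τ) := by
  have : (m : ℂ) ≠ 0 := mod_cast hm
  rw [jacobiTheta₂_term, ← Complex.exp_add]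
  congr 1
  field_simp
  ring

lemma thetaJ_eq_jacobiTheta₂ (hm : m ≠ 0) (r : ℕ) (τ z : ℂ) :
    thetaJ m r τ z = cexp (2 * π * I * (r ^ 2 * τ / (4 * m) + r * z)) *
      jacobiTheta₂ (r * τ + 2 * m * z) (2 * m * τ) := by
  simp only [thetaJ, thetaJ_term_eq hm, tsum_mul_left, jacobiTheta₂]

lemma im_two_mul_natCast_mul_pos (hm : m ≠ 0) (hτ : 0 < τ.im) : 0 < (2 * m * τ).im := by
  have : 0 < m := Nat.pos_of_ne_zero hm
  rw [show (2 * m * τ : ℂ) = ((2 * m : ℝ) : ℂ) * τ by push_cast; ring, im_ofReal_mul]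
  positivity

lemma hasSum_thetaJ (hm : m ≠ 0) (r : ℕ) (hτ : 0 < τ.im) (z : ℂ) :
    HasSum (fun n : ℤ ↦ cexp (2 * π * I * m * (((n : ℂ) + (r : ℂ) / (2 * m)) ^ 2 * τ +
      2 * ((n : ℂ) + (r : ℂ) / (2 * m)) * z))) (thetaJ m r τ z) := by
  simp only [thetaJ_eq_jacobiTheta₂ hm, thetaJ_term_eq hm]
  exact (hasSum_jacobiTheta₂_term _ (im_two_mul_natCast_mul_pos hm hτ)).mul_left _

lemma differentiableOn_thetaJ (hm : m ≠ 0) (r : ℕ) :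
    DifferentiableOn ℂ (fun p : ℂ × ℂ ↦ thetaJ m r p.1 p.2) {p | 0 < p.1.im} := by
  intro p hp
  refine DifferentiableAt.differentiableWithinAt ?_
  simp only [thetaJ_eq_jacobiTheta₂ hm]
  have h1 : DifferentiableAt ℂ (fun q : ℂ × ℂ ↦ jacobiTheta₂ q.1 q.2)
      (r * p.1 + 2 * m * p.2, 2 * m * p.1) :=
    (hasFDerivAt_jacobiTheta₂ _ (im_two_mul_natCast_mul_pos hm hp)).differentiableAt
  have h2 : DifferentiableAt ℂ (fun p : ℂ × ℂ ↦ (r * p.1 + 2 * m * p.2, 2 * m * p.1)) p := by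
    fun_prop
  refine .mul (by fun_prop) ?_
  exact DifferentiableAt.comp p h1 h2

lemma differentiableAt_thetaJ (hm : m ≠ 0) (r : ℕ) {p : ℂ × ℂ} (hp : 0 < p.1.im) :
    DifferentiableAt ℂ (fun p : ℂ × ℂ ↦ thetaJ m r p.1 p.2) p :=
  (differentiableOn_thetaJ hm r).differentiableAt
    ((isOpen_upperHalfPlaneSet.preimage continuous_fst).mem_nhds hp)

lemma differentiableAt_thetaJ_snd (hm : m ≠ 0) (r : ℕ) (hτ : 0 < τ.im) (z : ℂ) :
    DifferentiableAt ℂ (fun z ↦ thetaJ m r τ z) z :=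
  (differentiableAt_thetaJ hm r (p := (τ, z)) hτ).comp z
    ((differentiableAt_const τ).prodMk differentiableAt_id)

lemma differentiableAt_theta (hm : m ≠ 0) (r : ℕ) (hτ : 0 < τ.im) :
    DifferentiableAt ℂ (theta m r) τ :=
  (differentiableAt_thetaJ hm r (p := (τ, 0)) hτ).comp (f := fun w ↦ (w, (0 : ℂ))) τ
    (differentiableAt_id.prodMk (differentiableAt_const 0))

lemma cexp_two_pi_I_intCast (n : ℤ) : cexp (2 * π * I * n) = 1 := by
  rw [mul_comm, exp_int_mul_two_pi_mul_I]

lemma cexp_add_two_pi_I_intCast (x : ℂ) (n : ℤ) : cexp (x + 2 * π * I * n) = cexp x := by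
  rw [Complex.exp_add, cexp_two_pi_I_intCast, mul_one]

lemma thetaJ_add_lattice (hm : m ≠ 0) (r : ℕ) (l μ : ℤ) (τ z : ℂ) :
    thetaJ m r τ (z + l * τ + μ) =
      cexp (-(2 * π * I * m * ((l : ℂ) ^ 2 * τ + 2 * l * z))) * thetaJ m r τ z := by
  have hm' : (m : ℂ) ≠ 0 := mod_cast hm
  simp only [thetaJ]
  rw [← (Equiv.addRight l).tsum_eq (fun n : ℤ ↦ cexp (2 * π * I * m *
    (((n : ℂ) + (r : ℂ) / (2 * m)) ^ 2 * τ + 2 * ((n : ℂ) + (r : ℂ) / (2 * m)) * z))),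
    ← tsum_mul_left]
  refine tsum_congr fun n ↦ ?_
  rw [← Complex.exp_add, ← mul_one (cexp (_ + _)),
    ← cexp_two_pi_I_intCast ((2 * m * n + r) * μ), ← Complex.exp_add]
  congr 1
  simp only [Equiv.coe_addRight]
  push_cast
  field_simp
  ring

lemma thetaJ_zero_eq (m : ℕ) (τ z : ℂ) : thetaJ m 0 τ z = thetaJ 1 0 (m * τ) (m * z) := by
  refine tsum_congr fun n ↦ ?_
  push_cast
  ring_nf

lemma thetaJ_self_eq (hm : m ≠ 0) (τ z : ℂ) : thetaJ m m τ z = thetaJ 1 1 (m * τ) (m * z) := by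
  have hm' : (m : ℂ) ≠ 0 := mod_cast hm
  refine tsum_congr fun n ↦ ?_
  push_cast
  congr 1
  field_simp

lemma thetaJ_add_intCast (hm : m ≠ 0) (r : ℕ) (n : ℤ) (τ z : ℂ) :
    thetaJ m r (τ + n) z = cexp (2 * π * I * (n * r ^ 2 / (4 * m))) * thetaJ m r τ z := by
  have hm' : (m : ℂ) ≠ 0 := mod_cast hm
  simp only [thetaJ]
  rw [← tsum_mul_left]
  refine tsum_congr fun j ↦ ?_
  rw [← Complex.exp_add, ← cexp_add_two_pi_I_intCast (_ + _) ((m * j ^ 2 + j * r) * n)]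
  congr 1
  push_cast
  field_simp
  ring

lemma hasSum_of_even_of_odd_int {E : Type*} [AddCommMonoid E] [TopologicalSpace E]
    [ContinuousAdd E] {f : ℤ → E} {a b : E} (he : HasSum (fun n ↦ f (2 * n)) a)
    (ho : HasSum (fun n ↦ f (2 * n + 1)) b) : HasSum f (a + b) := by
  have h2 := mul_right_injective₀ (two_ne_zero' ℤ)
  replace ho := ((add_left_injective (1 : ℤ)).comp h2).hasSum_range_iff.2 ho
  refine (h2.hasSum_range_iff.2 he).add_isCompl ?_ ho
  convert! Int.isCompl_even_odd using 1
  · ext x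
    simp [even_iff_exists_two_mul]
  · ext x
    simp [Set.mem_range, Odd, eq_comm]

lemma jacobiTheta₂_sub_half (r : ℕ) (hτ : 0 < τ.im) (z : ℂ) :
    jacobiTheta₂ (z - r / 2) (τ / 2) = thetaJ 1 0 τ z + (-1) ^ r * thetaJ 1 1 τ z := by
  have h2 : 0 < (τ / 2).im := by
    rw [div_ofNat_im]
    positivity
  refine (hasSum_jacobiTheta₂_term _ h2).unique (hasSum_of_even_of_odd_int ?_ ?_)
  · refine (hasSum_thetaJ one_ne_zero 0 hτ z).congr_fun fun n ↦ ?_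
    rw [jacobiTheta₂_term, ← cexp_add_two_pi_I_intCast _ (n * r)]
    push_cast
    ring_nf
  · refine ((hasSum_thetaJ one_ne_zero 1 hτ z).mul_left _).congr_fun fun n ↦ ?_
    rw [jacobiTheta₂_term, ← Complex.exp_pi_mul_I, ← Complex.exp_nat_mul, ← Complex.exp_add,
      ← cexp_add_two_pi_I_intCast _ ((n + 1) * r)]
    push_cast
    ring_nf

lemma neg_I_mul_half_cpow (hτ : 0 < τ.im) :
    (-I * (τ / 2)) ^ (1 / 2 : ℂ) = (-I / 2) ^ (1 / 2 : ℂ) * τ ^ (1 / 2 : ℂ) := by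
  have h0 : τ ≠ 0 := by
    rintro rfl
    simp at hτ
  have h1 : arg (-I / 2) = -(π / 2) := by
    rw [show -I / 2 = ((1 / 2 : ℝ) : ℂ) * -I by push_cast; ring, arg_real_mul _ (by norm_num),
      arg_neg_I]
  have h2 : 0 ≤ arg τ := arg_nonneg_iff.2 hτ.le
  rw [show -I * (τ / 2) = -I / 2 * τ by ring, cpow_def_of_ne_zero (by simp [h0]),
    cpow_def_of_ne_zero (by simp), cpow_def_of_ne_zero h0, ← Complex.exp_add,
    Complex.log_mul (by simp) h0 (by rw [h1]; constructor <;> linarith [arg_le_pi τ, Real.pi_pos])]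
  ring_nf

theorem thetaJ_one_neg_one_div (r : ℕ) (hτ : 0 < τ.im) (z : ℂ) :
    thetaJ 1 r (-1 / τ) (z / τ) = (-I / 2) ^ (1 / 2 : ℂ) * τ ^ (1 / 2 : ℂ) *
      cexp (2 * π * I * (z ^ 2 / τ)) * (thetaJ 1 0 τ z + (-1) ^ r * thetaJ 1 1 τ z) := by
  have h0 : τ ≠ 0 := by
    rintro rfl
    simp at hτ
  have hne : (-I * (τ / 2)) ^ (1 / 2 : ℂ) ≠ 0 := by
    simp [cpow_eq_zero_iff, h0]
  have harg : (r * (-1 / τ) + 2 * (1 : ℕ) * (z / τ) : ℂ) = (z - r / 2) / (τ / 2) := by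
    push_cast
    field_simp
    ring
  have hinv : (2 * (1 : ℕ) * (-1 / τ) : ℂ) = -1 / (τ / 2) := by
    push_cast
    field_simp
  have hexp : cexp (2 * π * I * (r ^ 2 * (-1 / τ) / (4 * (1 : ℕ)) + r * (z / τ))) =
      cexp (2 * π * I * (z ^ 2 / τ)) * cexp (-π * I * (z - r / 2) ^ 2 / (τ / 2)) := by
    rw [← Complex.exp_add]
    congr 1
    push_cast
    field_simp
    ring
  rw [← jacobiTheta₂_sub_half r hτ, jacobiTheta₂_functional_equation, ← neg_I_mul_half_cpow hτ,
    thetaJ_eq_jacobiTheta₂ one_ne_zero, harg, hinv, hexp]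
  field_simp [hne]

lemma hasSum_theta (hm : m ≠ 0) (r : ℕ) (hτ : 0 < τ.im) :
    HasSum (fun n : ℤ ↦ (1 : ℂ) * cexp (I * (2 * π * m * (n + r / (2 * m)) ^ 2 : ℝ) * τ))
      (theta m r τ) := by
  refine (hasSum_thetaJ hm r hτ 0).congr_fun fun n ↦ ?_
  rw [one_mul]
  push_cast
  ring_nf

lemma hasSum_deriv_theta (hm : m ≠ 0) (r : ℕ) (hτ : 0 < τ.im) :
    HasSum (fun n : ℤ ↦ 1 * (I * (2 * π * m * (n + r / (2 * m)) ^ 2 : ℝ)) *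
      cexp (I * (2 * π * m * (n + r / (2 * m)) ^ 2 : ℝ) * τ)) (deriv (theta m r) τ) := by
  have h := hasSum_deriv_tsum_cexp (c := fun _ : ℤ ↦ 1)
    (y := fun n : ℤ ↦ (2 * π * m * (n + r / (2 * m)) ^ 2 : ℝ)) (fun n _ ↦ by positivity)
    (fun w hw ↦ (hasSum_theta hm r hw).summable) hτ
  have hev : (fun w ↦ ∑' n : ℤ, 1 * cexp (I * (2 * π * m * (n + r / (2 * m)) ^ 2 : ℝ) * w)) =ᶠ[𝓝 τ]
      theta m r := by
    filter_upwards [isOpen_upperHalfPlaneSet.mem_nhds hτ] with w hw using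
      (hasSum_theta hm r hw).tsum_eq
  rwa [hev.deriv_eq] at h

/-- The heat equation at `z = 0`. -/
lemma iteratedDeriv_two_thetaJ (hm : m ≠ 0) (r : ℕ) (hτ : 0 < τ.im) :
    iteratedDeriv 2 (fun z ↦ thetaJ m r τ z) 0 = 8 * π * I * m * deriv (theta m r) τ := by
  have hz (z : ℂ) : HasSum (fun n : ℤ ↦ cexp (I * (2 * π * m * (n + r / (2 * m)) ^ 2 : ℝ) * τ) *
      cexp (I * (4 * π * m * (n + r / (2 * m)) : ℝ) * z)) (thetaJ m r τ z) := by
    convert! hasSum_thetaJ hm r hτ z using 2 with n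
    rw [← Complex.exp_add]
    push_cast
    ring_nf
  have h := hasSum_iteratedDeriv_tsum_cexp (fun z ↦ (hz z).summable) 2
  simp only [fun z ↦ (hz z).tsum_eq] at h
  refine h.unique ?_
  convert! (hasSum_deriv_theta hm r hτ).mul_left (8 * π * I * m) using 2 with n
  push_cast
  ring

lemma hasSum_fourier_thetaJ (hm : m ≠ 0) (r : ℕ) (hτ : 0 < τ.im) (b : ℕ) (t : ℝ) :
    HasSum (fun n : ℤ ↦ cexp (2 * π * I * ((2 * m * n + r) ^ 2 * τ / (4 * m))) *
      cexp (2 * π * I * ((((2 * m * n + r) * b : ℤ) : ℂ) * (t : ℂ)))) (thetaJ m r τ (b * t)) := by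
  have hm' : (m : ℂ) ≠ 0 := mod_cast hm
  convert! hasSum_thetaJ hm r hτ (b * t) using 2 with n
  rw [← Complex.exp_add]
  congr 1
  push_cast
  field_simp
  ring

lemma hasSum_fourierMode_thetaJ (hm : m ≠ 0) (r : ℕ) (hτ : 0 < τ.im) (b : ℕ) (a : ℤ) :
    HasSum (fun n : ℤ ↦ if (2 * m * n + r) * b = a then
        cexp (2 * π * I * ((2 * m * n + r) ^ 2 * τ / (4 * m))) else 0)
      (fourierMode a fun z ↦ thetaJ m r τ (b * z)) :=
  hasSum_fourierMode (fun t ↦ hasSum_fourier_thetaJ hm r hτ b t) a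

end Theta

/-! ### The automorphy factor -/

lemma autFactor_eq_denom (γ : SL(2, ℤ)) (τ : ℍ) : autFactor γ τ = denom γ τ := by
  simp [autFactor, ModularGroup.denom_apply]

lemma autFactor_ne_zero (γ : SL(2, ℤ)) (τ : ℍ) : autFactor γ τ ≠ 0 := by
  rw [autFactor_eq_denom]
  exact denom_ne_zero _ τ

lemma coe_smul_eq (γ : SL(2, ℤ)) (τ : ℍ) :
    ((γ • τ : ℍ) : ℂ) = ((γ 0 0 : ℂ) * τ + γ 0 1) / autFactor γ τ := by
  rw [coe_specialLinearGroup_apply]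
  simp [autFactor]

lemma det_eq_one (γ : SL(2, ℤ)) : (γ 0 0 : ℂ) * γ 1 1 - γ 0 1 * γ 1 0 = 1 := by
  have := γ.det_coe
  rw [Matrix.det_fin_two] at this
  exact_mod_cast this

lemma mul_apply_one_zero (γ δ : SL(2, ℤ)) :
    (γ * δ) 1 0 = γ 1 0 * δ 0 0 + γ 1 1 * δ 1 0 := by
  simp [Matrix.SpecialLinearGroup.coe_mul, Matrix.mul_apply, Fin.sum_univ_two]

lemma mul_apply_one_one (γ δ : SL(2, ℤ)) :
    (γ * δ) 1 1 = γ 1 0 * δ 0 1 + γ 1 1 * δ 1 1 := by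
  simp [Matrix.SpecialLinearGroup.coe_mul, Matrix.mul_apply, Fin.sum_univ_two]

lemma autFactor_mul (γ δ : SL(2, ℤ)) (τ : ℍ) :
    autFactor (γ * δ) τ = autFactor γ (δ • τ) * autFactor δ τ := by
  have h := autFactor_ne_zero δ τ
  rw [autFactor, autFactor, mul_apply_one_zero, mul_apply_one_one, coe_smul_eq]
  field_simp
  simp only [autFactor]
  push_cast
  ring

lemma jacobi_exponent_mul (γ δ : SL(2, ℤ)) (τ : ℍ) (z : ℂ) :
    ((γ * δ) 1 0 : ℂ) * z ^ 2 / autFactor (γ * δ) τ =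
      (γ 1 0 : ℂ) * (z / autFactor δ τ) ^ 2 / autFactor γ (δ • τ) +
        (δ 1 0 : ℂ) * z ^ 2 / autFactor δ τ := by
  have h := autFactor_ne_zero δ τ
  have h' := autFactor_ne_zero γ (δ • τ)
  have e := autFactor_mul γ δ τ
  have hd := det_eq_one δ
  have key : ((γ * δ) 1 0 : ℂ) * autFactor δ τ = γ 1 0 + δ 1 0 * autFactor (γ * δ) τ := by
    simp only [autFactor, mul_apply_one_zero, mul_apply_one_one]
    push_cast
    linear_combination (γ 1 0 : ℂ) * hd
  rw [e] at key ⊢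
  field_simp
  linear_combination z ^ 2 * key

lemma autFactor_T_zpow (n : ℤ) (τ : ℍ) : autFactor (ModularGroup.T ^ n) τ = 1 := by
  simp [autFactor, ModularGroup.coe_T_zpow]

lemma autFactor_S (τ : ℍ) : autFactor ModularGroup.S τ = τ := by
  simp [autFactor, ModularGroup.S]

lemma coe_T_zpow_smul (n : ℤ) (τ : ℍ) : ((ModularGroup.T ^ n • τ : ℍ) : ℂ) = τ + n := by
  rw [modular_T_zpow_smul, coe_vadd, ofReal_intCast, add_comm]

lemma coe_T_smul (τ : ℍ) : ((ModularGroup.T • τ : ℍ) : ℂ) = τ + 1 := by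
  simpa using coe_T_zpow_smul 1 τ

lemma coe_S_smul (τ : ℍ) : ((ModularGroup.S • τ : ℍ) : ℂ) = -1 / τ := by
  rw [modular_S_smul, coe_mk, inv_neg, neg_div, one_div]

lemma slash_apply_autFactor (f : ℍ → ℂ) (k : ℤ) (g : SL(2, ℤ)) (τ : ℍ) :
    (f ∣[k] g) τ = f (g • τ) * autFactor g τ ^ (-k) := by
  rw [SL_slash_apply, autFactor_eq_denom]

lemma continuous_autFactor_cpow (γ : SL(2, ℤ)) :
    Continuous fun τ : ℍ ↦ autFactor γ τ ^ (1 / 2 : ℂ) := by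
  rcases eq_or_ne (γ 1 0) 0 with h | h
  · simp only [autFactor, h]
    simpa using continuous_const
  · refine continuous_iff_continuousAt.2 fun τ ↦ ?_
    have h1 : Continuous fun τ : ℍ ↦ autFactor γ τ := by
      unfold autFactor
      fun_prop
    refine h1.continuousAt.cpow continuousAt_const (mem_slitPlane_iff.2 (Or.inr ?_))
    simp only [autFactor, add_im, mul_im, intCast_im, intCast_re, zero_mul, add_zero]
    exact mul_ne_zero (mod_cast h) τ.im_ne_zero

lemma cpow_half_sq (w : ℂ) : (w ^ (1 / 2 : ℂ)) ^ 2 = w := by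
  rw [← cpow_nat_mul]
  norm_num

lemma cpow_half_ne_zero {w : ℂ} (hw : w ≠ 0) : w ^ (1 / 2 : ℂ) ≠ 0 := by
  simp [cpow_eq_zero_iff, hw]

lemma exists_autFactor_mul_cpow (γ δ : SL(2, ℤ)) :
    ∃ ε : ℂ, ε ^ 2 = 1 ∧ ∀ τ : ℍ, autFactor (γ * δ) τ ^ (1 / 2 : ℂ) =
      ε * (autFactor γ (δ • τ) ^ (1 / 2 : ℂ) * autFactor δ τ ^ (1 / 2 : ℂ)) := by
  have hcont : Continuous fun τ : ℍ ↦ δ • τ :=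
    continuous_const_smul (δ : GL (Fin 2) ℝ)
  have h := (isPreconnected_univ (α := ℍ)).eq_or_eq_neg_of_sq_eq
    (f := fun τ ↦ autFactor (γ * δ) τ ^ (1 / 2 : ℂ))
    (g := fun τ ↦ autFactor γ (δ • τ) ^ (1 / 2 : ℂ) * autFactor δ τ ^ (1 / 2 : ℂ))
    (continuous_autFactor_cpow _).continuousOn
    (((continuous_autFactor_cpow γ).comp hcont).mul (continuous_autFactor_cpow δ)).continuousOn
    (fun τ _ ↦ by
      simp only [Pi.pow_apply, mul_pow, cpow_half_sq, autFactor_mul])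
    (fun {τ} _ ↦ mul_ne_zero (cpow_half_ne_zero (autFactor_ne_zero _ _))
      (cpow_half_ne_zero (autFactor_ne_zero _ _)))
  rcases h with h | h
  · exact ⟨1, by simp, fun τ ↦ by simpa using h (Set.mem_univ τ)⟩
  · exact ⟨-1, by simp, fun τ ↦ by simpa using h (Set.mem_univ τ)⟩

/-! ### The theta multiplier -/

lemma IsThetaMultiplier.mul {m : ℕ} {γ δ : SL(2, ℤ)} {U V : Matrix (Fin (2 * m)) (Fin (2 * m)) ℂ}
    (hU : IsThetaMultiplier m γ U) (hV : IsThetaMultiplier m δ V) :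
    ∃ ε : ℂ, ε ^ 2 = 1 ∧ IsThetaMultiplier m (γ * δ) (ε • (U * V)) := by
  obtain ⟨ε, hε, h⟩ := exists_autFactor_mul_cpow γ δ
  refine ⟨ε, hε, fun τ z r ↦ ?_⟩
  have e : z / autFactor (γ * δ) τ = z / autFactor δ τ / autFactor γ (δ • τ) := by
    rw [autFactor_mul, div_div, mul_comm]
  rw [mul_smul, e, hU, jacobi_exponent_mul, h, mul_add, Complex.exp_add]
  simp only [hV τ z, Matrix.smul_apply, Matrix.mul_apply, smul_eq_mul, Finset.mul_sum,
    Finset.sum_mul]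
  rw [Finset.sum_comm]
  refine Finset.sum_congr rfl fun s _ ↦ Finset.sum_congr rfl fun t _ ↦ ?_
  linear_combination (-(cexp (2 * π * I * m * (γ 1 0 * (z / autFactor δ τ) ^ 2 /
    autFactor γ (δ • τ))) * cexp (2 * π * I * m * (δ 1 0 * z ^ 2 / autFactor δ τ)) *
    (autFactor γ (δ • τ) ^ (1 / 2 : ℂ) * autFactor δ τ ^ (1 / 2 : ℂ)) * U r t * V t s *
    thetaJ m s τ z)) * hε

lemma isThetaMultiplier_one_iff {γ : SL(2, ℤ)} {U : Matrix (Fin (2 * 1)) (Fin (2 * 1)) ℂ} :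
    IsThetaMultiplier 1 γ U ↔ ∀ (τ : ℍ) (z : ℂ),
      thetaJ 1 0 ((γ • τ : ℍ) : ℂ) (z / autFactor γ τ) =
        cexp (2 * π * I * ((γ 1 0 : ℂ) * z ^ 2 / autFactor γ τ)) * autFactor γ τ ^ (1 / 2 : ℂ) *
          (U 0 0 * thetaJ 1 0 τ z + U 0 1 * thetaJ 1 1 τ z) ∧
      thetaJ 1 1 ((γ • τ : ℍ) : ℂ) (z / autFactor γ τ) =
        cexp (2 * π * I * ((γ 1 0 : ℂ) * z ^ 2 / autFactor γ τ)) * autFactor γ τ ^ (1 / 2 : ℂ) *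
          (U 1 0 * thetaJ 1 0 τ z + U 1 1 * thetaJ 1 1 τ z) := by
  simp only [IsThetaMultiplier, Nat.cast_one, mul_one]
  refine forall₂_congr fun τ z ↦ ?_
  exact Fin.forall_fin_two.trans (by simp [Fin.sum_univ_two])

lemma isThetaMultiplier_T_zpow (n : ℤ) :
    IsThetaMultiplier 1 (ModularGroup.T ^ n) !![1, 0; 0, cexp (2 * π * I * (n / 4))] := by
  refine isThetaMultiplier_one_iff.2 fun τ z ↦ ?_
  rw [coe_T_zpow_smul, autFactor_T_zpow, thetaJ_add_intCast one_ne_zero,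
    thetaJ_add_intCast one_ne_zero]
  simp [ModularGroup.coe_T_zpow]

lemma isThetaMultiplier_S : IsThetaMultiplier 1 ModularGroup.S
    ((-I / 2) ^ (1 / 2 : ℂ) • !![1, 1; 1, -1]) := by
  refine isThetaMultiplier_one_iff.2 fun τ z ↦ ?_
  rw [coe_S_smul, autFactor_S, thetaJ_one_neg_one_div 0 τ.im_pos, thetaJ_one_neg_one_div 1 τ.im_pos]
  constructor <;> simp [ModularGroup.S] <;> ring

lemma det_thetaMultiplier_S : ((-I / 2) ^ (1 / 2 : ℂ) • !![1, 1; 1, -1]).det = I := by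
  rw [Matrix.det_smul, Matrix.det_fin_two_of, Fintype.card_fin, cpow_half_sq]
  ring

lemma norm_cexp_two_pi_I_mul_ofReal (x : ℝ) : ‖cexp (2 * π * I * x)‖ = 1 := by
  simp [norm_exp]

lemma exists_isThetaMultiplier_mul {γ δ : SL(2, ℤ)}
    (hγ : ∃ U, IsThetaMultiplier 1 γ U ∧ ‖U.det‖ = 1)
    (hδ : ∃ U, IsThetaMultiplier 1 δ U ∧ ‖U.det‖ = 1) :
    ∃ U, IsThetaMultiplier 1 (γ * δ) U ∧ ‖U.det‖ = 1 := by
  obtain ⟨U, hU, hdetU⟩ := hγ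
  obtain ⟨V, hV, hdetV⟩ := hδ
  obtain ⟨ε, hε, h⟩ := hU.mul hV
  refine ⟨_, h, ?_⟩
  rw [Matrix.det_smul, Matrix.det_mul, Fintype.card_fin, hε, one_mul, norm_mul, hdetU, hdetV,
    one_mul]

theorem exists_isThetaMultiplier (γ : SL(2, ℤ)) :
    ∃ U, IsThetaMultiplier 1 γ U ∧ ‖U.det‖ = 1 := by
  have hT (n : ℤ) : ∃ U, IsThetaMultiplier 1 (ModularGroup.T ^ n) U ∧ ‖U.det‖ = 1 := by
    refine ⟨_, isThetaMultiplier_T_zpow n, ?_⟩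
    rw [Matrix.det_fin_two_of, one_mul, zero_mul, sub_zero]
    exact_mod_cast norm_cexp_two_pi_I_mul_ofReal (n / 4)
  have hS : ∃ U, IsThetaMultiplier 1 ModularGroup.S U ∧ ‖U.det‖ = 1 :=
    ⟨_, isThetaMultiplier_S, by rw [det_thetaMultiplier_S, norm_I]⟩
  have hmem : γ ∈ Subgroup.closure {ModularGroup.S, ModularGroup.T} := by
    rw [SpecialLinearGroup.SL2Z_generators]
    exact Subgroup.mem_top γ
  induction hmem using Subgroup.closure_induction'' with
  | mem x hx =>
    rcases hx with rfl | rfl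
    · exact hS
    · simpa using hT 1
  | inv_mem x hx =>
    rcases hx with rfl | rfl
    · rw [show ModularGroup.S⁻¹ = ModularGroup.S * (ModularGroup.S * ModularGroup.S) by decide]
      exact exists_isThetaMultiplier_mul hS (exists_isThetaMultiplier_mul hS hS)
    · simpa using hT (-1)
  | one => simpa using hT 0
  | mul x y _ _ hx hy => exact exists_isThetaMultiplier_mul hx hy

/-! ### Functions with the multiplier of `η ^ 6` -/

lemma tendsto_eta_pow_six_mul_cexp :
    Tendsto (fun τ : ℍ ↦ η τ ^ 6 * cexp (-(2 * π * I * (τ / 4)))) atImInfty (𝓝 1) := by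
  have hprod : Tendsto (fun q : ℂ ↦ ∏' n : ℕ, (1 - q ^ (n + 1))) (𝓝 0) (𝓝 1) := by
    have h := (differentiableOn_tprod_one_sub_pow.differentiableAt
      (Metric.ball_mem_nhds 0 one_pos)).continuousAt.tendsto
    simpa using h
  have h := (hprod.comp (qParam_tendsto_atImInfty zero_lt_one)).pow 6
  rw [one_pow] at h
  refine h.congr fun τ ↦ ?_
  have e : Function.Periodic.qParam 24 (τ : ℂ) ^ 6 * cexp (-(2 * π * I * (τ / 4))) = 1 := by
    rw [Function.Periodic.qParam, ← Complex.exp_nat_mul, ← Complex.exp_add, ← Complex.exp_zero]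
    congr 1
    push_cast
    ring
  simp only [Function.comp_apply, ModularForm.eta, eta_q]
  linear_combination (-(∏' n : ℕ, (1 - Function.Periodic.qParam 1 (τ : ℂ) ^ (n + 1))) ^ 6) * e

lemma cexp_two_pi_I_div_four : cexp (2 * π * I * (1 / 4)) = I := by
  rw [show 2 * π * I * (1 / 4) = π / 2 * I by ring, Complex.exp_pi_div_two_mul_I]

lemma eta_add_one_pow_six (τ : ℂ) : η (τ + 1) ^ 6 = I * η τ ^ 6 := by
  have e : Function.Periodic.qParam 24 (τ + 1) ^ 6 = I * Function.Periodic.qParam 24 τ ^ 6 := by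
    have harg : (6 : ℕ) * (2 * π * I * (τ + 1) / (24 : ℝ)) =
        2 * π * I * (1 / 4) + (6 : ℕ) * (2 * π * I * τ / (24 : ℝ)) := by
      push_cast
      ring
    rw [Function.Periodic.qParam, Function.Periodic.qParam, ← Complex.exp_nat_mul,
      ← Complex.exp_nat_mul, harg, Complex.exp_add, cexp_two_pi_I_div_four]
  have hper : Function.Periodic.qParam 1 (τ + 1) = Function.Periodic.qParam 1 τ := by
    simp [Function.Periodic.qParam, mul_add, Complex.exp_add]
  simp only [ModularForm.eta, eta_q, hper, mul_pow, e]
  ring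

lemma eta_neg_one_div_pow_six {τ : ℂ} (hτ : 0 < τ.im) :
    η (-1 / τ) ^ 6 = I * τ ^ 3 * η τ ^ 6 := by
  have hsq (w : ℂ) : Complex.sqrt w ^ 6 = w ^ 3 := by
    rw [Complex.sqrt, ← one_div, show 6 = 2 * 3 by norm_num, pow_mul, cpow_half_sq]
  have h : η (-1 / τ) = (Complex.sqrt I)⁻¹ * (Complex.sqrt τ * η τ) := eta_comp_eq_csqrt_I_inv hτ
  rw [h, mul_pow, mul_pow, inv_pow, hsq, hsq, I_pow_three, inv_neg, inv_I, neg_neg]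
  ring

lemma mdifferentiable_eta : MDiff fun τ : ℍ ↦ η τ :=
  UpperHalfPlane.mdifferentiable_iff.2 fun _ hτ ↦
    (differentiableAt_eta_of_mem_upperHalfPlaneSet hτ).differentiableWithinAt.congr
      (fun w hw ↦ by simp [ofComplex_apply_of_im_pos hw])
      (by simp [ofComplex_apply_of_im_pos hτ])

lemma eq_const_of_levelOne_invariant {f : ℍ → ℂ} (hf : MDiff f)
    (hT : ∀ τ, f (ModularGroup.T • τ) = f τ) (hS : ∀ τ, f (ModularGroup.S • τ) = f τ) {L : ℂ}
    (hL : Tendsto f atImInfty (𝓝 L)) (τ : ℍ) : f τ = L := by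
  have hslash (γ : SL(2, ℤ)) : f ∣[(0 : ℤ)] γ = f := by
    refine SlashInvariantForm.slash_action_generators_SL2Z ?_ ?_ γ <;> ext τ
    · rw [slash_apply_autFactor, hS, neg_zero, zpow_zero, mul_one]
    · rw [slash_apply_autFactor, hT, neg_zero, zpow_zero, mul_one]
  let F : ModularForm 𝒮ℒ 0 :=
    { toFun := f
      slash_action_eq' := by
        rintro _ ⟨γ, rfl⟩
        exact hslash γ
      holo' := hf
      bdd_at_cusps' := fun hc ↦ by
        rw [Subgroup.IsArithmetic.isCusp_iff_isCusp_SL2Z] at hc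
        rw [OnePoint.isBoundedAt_iff_forall_SL2Z hc]
        intro γ _
        rw [hslash]
        exact hL.isBigO_one ℝ }
  obtain ⟨c, hc⟩ := ModularFormClass.levelOne_weight_zero_const F
  obtain rfl : f = fun _ ↦ c := hc
  exact tendsto_nhds_unique tendsto_const_nhds hL

theorem eq_const_mul_eta_pow_six {V : ℍ → ℂ} (hV : MDiff V)
    (hT : ∀ τ, V (ModularGroup.T • τ) = I * V τ)
    (hS : ∀ τ, V (ModularGroup.S • τ) = I * τ ^ 3 * V τ) {L : ℂ}
    (hL : Tendsto (fun τ : ℍ ↦ V τ * cexp (-(2 * π * I * (τ / 4)))) atImInfty (𝓝 L)) (τ : ℍ) :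
    V τ = L * η τ ^ 6 := by
  have hne (τ : ℍ) : η τ ^ 6 ≠ 0 := pow_ne_zero _ (eta_ne_zero τ.2)
  have hdiff : MDiff fun τ : ℍ ↦ V τ / η τ ^ 6 := by
    have h := mdifferentiable_eta
    rw [UpperHalfPlane.mdifferentiable_iff] at hV h ⊢
    exact hV.div (h.pow 6) fun τ _ ↦ hne (ofComplex τ)
  refine (div_eq_iff (hne τ)).1 (eq_const_of_levelOne_invariant hdiff (fun τ ↦ ?_) (fun τ ↦ ?_)
    ?_ τ)
  · rw [hT, coe_T_smul, eta_add_one_pow_six, mul_div_mul_left _ _ I_ne_zero]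
  · rw [hS, coe_S_smul, eta_neg_one_div_pow_six τ.2, mul_div_mul_left]
    exact mul_ne_zero I_ne_zero (pow_ne_zero 3 τ.ne_zero)
  · have h := hL.div tendsto_eta_pow_six_mul_cexp one_ne_zero
    rw [div_one] at h
    exact h.congr fun τ ↦ mul_div_mul_right _ _ (Complex.exp_ne_zero _)

/-! ### The form `θ_{1,1}(τ) θ^J_{1,0}(τ,z) - θ_{1,0}(τ) θ^J_{1,1}(τ,z)` -/

lemma iteratedDeriv_two_comp_div {F : ℂ → ℂ} (hF : Differentiable ℂ F) (j : ℂ) :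
    iteratedDeriv 2 (fun z ↦ F (z / j)) 0 = iteratedDeriv 2 F 0 / j ^ 2 := by
  have h := congrFun (iteratedDeriv_comp_const_mul (n := 2) hF.contDiff j⁻¹) 0
  simpa only [div_eq_inv_mul, inv_pow, mul_zero] using h

lemma iteratedDeriv_two_cexp_mul {F : ℂ → ℂ} (hF : Differentiable ℂ F) (b : ℂ) :
    iteratedDeriv 2 (fun z ↦ cexp (b * z ^ 2) * F z) 0 = 2 * b * F 0 + iteratedDeriv 2 F 0 := by
  have hexp (z : ℂ) : HasDerivAt (fun z ↦ cexp (b * z ^ 2))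
      (cexp (b * z ^ 2) * (b * (2 * z))) z := by
    simpa using (((hasDerivAt_id' z).pow 2).const_mul b).cexp
  have hderiv : deriv (fun z ↦ cexp (b * z ^ 2) * F z) =
      fun z ↦ cexp (b * z ^ 2) * (2 * b * z * F z + deriv F z) := by
    ext z
    refine (((hexp z).mul (hF z).hasDerivAt).congr_deriv ?_).deriv
    ring
  have hlin : HasDerivAt (fun z ↦ 2 * b * z * F z + deriv F z)
      (2 * b * F 0 + iteratedDeriv 2 F 0) 0 := by
    refine ((((hasDerivAt_id' (0 : ℂ)).const_mul (2 * b)).mul (hF 0).hasDerivAt).add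
      (hF.deriv 0).hasDerivAt).congr_deriv ?_
    rw [iteratedDeriv_succ, iteratedDeriv_one]
    ring
  rw [iteratedDeriv_succ, iteratedDeriv_one, hderiv]
  refine ((hexp 0).mul hlin).deriv.trans ?_
  simp

/-- The Jacobi form of weight and index `1` for `SL₂(ℤ)`, with multiplier `det U_1`, formed from the
theta vector and its value at `z = 0`. -/
def thetaWedge (τ z : ℂ) : ℂ := theta 1 1 τ * thetaJ 1 0 τ z - theta 1 0 τ * thetaJ 1 1 τ z

lemma thetaWedge_zero (τ : ℂ) : thetaWedge τ 0 = 0 := by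
  simp [thetaWedge, theta, mul_comm]

lemma thetaWedge_mul {m : ℕ} (hm : m ≠ 0) (τ z : ℂ) :
    thetaWedge (m * τ) (m * z) = theta m m τ * thetaJ m 0 τ z - theta m 0 τ * thetaJ m m τ z := by
  simp only [thetaWedge, theta, thetaJ_zero_eq m, thetaJ_self_eq hm, mul_zero]

lemma thetaWedge_add_intCast (n : ℤ) (τ z : ℂ) :
    thetaWedge (τ + n) z = cexp (2 * π * I * (n / 4)) * thetaWedge τ z := by
  simp only [thetaWedge, theta, thetaJ_add_intCast one_ne_zero]
  push_cast
  ring_nf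
  simp

lemma differentiable_thetaWedge {τ : ℂ} (hτ : 0 < τ.im) : Differentiable ℂ (thetaWedge τ) := by
  intro z
  exact ((differentiableAt_thetaJ_snd one_ne_zero 0 hτ z).const_mul _).sub
    ((differentiableAt_thetaJ_snd one_ne_zero 1 hτ z).const_mul _)

lemma thetaWedge_smul {γ : SL(2, ℤ)} {U : Matrix (Fin (2 * 1)) (Fin (2 * 1)) ℂ}
    (hU : IsThetaMultiplier 1 γ U) (τ : ℍ) (z : ℂ) :
    thetaWedge ((γ • τ : ℍ) : ℂ) (z / autFactor γ τ) =
      autFactor γ τ * cexp (2 * π * I * ((γ 1 0 : ℂ) * z ^ 2 / autFactor γ τ)) * U.det *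
        thetaWedge τ z := by
  obtain ⟨h1, h2⟩ := isThetaMultiplier_one_iff.1 hU τ z
  obtain ⟨h3, h4⟩ := isThetaMultiplier_one_iff.1 hU τ 0
  have hdet : U.det = U 0 0 * U 1 1 - U 0 1 * U 1 0 := Matrix.det_fin_two U
  simp only [zero_div, ne_eq, OfNat.ofNat_ne_zero, not_false_eq_true, zero_pow, mul_zero,
    Complex.exp_zero, one_mul] at h3 h4
  simp only [thetaWedge, theta]
  rw [h1, h2, h3, h4, hdet]
  conv_rhs => enter [1, 1, 1]; rw [← cpow_half_sq (autFactor γ τ)]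
  ring

lemma iteratedDeriv_two_thetaWedge (τ : ℍ) :
    iteratedDeriv 2 (thetaWedge τ) 0 = 8 * π * I * xiStar 1 τ := by
  have hd (r : ℕ) : ContDiffAt ℂ 2 (fun z ↦ thetaJ 1 r τ z) 0 :=
    (Differentiable.contDiff fun z ↦
      differentiableAt_thetaJ_snd one_ne_zero r τ.im_pos z).contDiffAt
  have e : thetaWedge τ = (fun z ↦ theta 1 1 τ * thetaJ 1 0 τ z) -
    (fun z ↦ theta 1 0 τ * thetaJ 1 1 τ z) := rfl
  rw [e, iteratedDeriv_sub (contDiffAt_const.mul (hd 0)) (contDiffAt_const.mul (hd 1)),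
    iteratedDeriv_const_mul_field, iteratedDeriv_const_mul_field,
    iteratedDeriv_two_thetaJ one_ne_zero 0 τ.im_pos,
    iteratedDeriv_two_thetaJ one_ne_zero 1 τ.im_pos, xiStar]
  push_cast
  ring

lemma xiStar_one_smul {γ : SL(2, ℤ)} {U : Matrix (Fin (2 * 1)) (Fin (2 * 1)) ℂ}
    (hU : IsThetaMultiplier 1 γ U) (τ : ℍ) :
    xiStar 1 (γ • τ) = U.det * autFactor γ τ ^ 3 * xiStar 1 τ := by
  have hj := autFactor_ne_zero γ τ
  have h1 := iteratedDeriv_two_comp_div (differentiable_thetaWedge (γ • τ).im_pos) (autFactor γ τ)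
  have h2 : (fun z ↦ thetaWedge ((γ • τ : ℍ) : ℂ) (z / autFactor γ τ)) = fun z ↦
      (autFactor γ τ * U.det) * (cexp (2 * π * I * (γ 1 0 : ℂ) / autFactor γ τ * z ^ 2) *
        thetaWedge τ z) := by
    ext z
    rw [thetaWedge_smul hU]
    ring_nf
  rw [h2, iteratedDeriv_const_mul_field,
    iteratedDeriv_two_cexp_mul (differentiable_thetaWedge τ.im_pos), thetaWedge_zero,
    iteratedDeriv_two_thetaWedge, iteratedDeriv_two_thetaWedge] at h1
  field_simp at h1
  apply mul_left_cancel₀ (show (8 * π * I : ℂ) ≠ 0 by simp)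
  linear_combination -(π * I) * h1

lemma differentiableOn_theta {m : ℕ} (hm : m ≠ 0) (r : ℕ) :
    DifferentiableOn ℂ (theta m r) {w | 0 < w.im} :=
  fun _ hw ↦ (differentiableAt_theta hm r hw).differentiableWithinAt

lemma mdifferentiable_of_differentiableOn {F : ℂ → ℂ} (hF : DifferentiableOn ℂ F {w | 0 < w.im}) :
    MDiff (fun τ : ℍ ↦ F τ) := by
  refine UpperHalfPlane.mdifferentiable_iff.2 (hF.congr fun w hw ↦ ?_)
  simp [ofComplex_apply_of_im_pos hw]

lemma mdifferentiable_xiStar {m : ℕ} (hm : m ≠ 0) : MDiff (xiStar m) := by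
  have h (r : ℕ) : DifferentiableOn ℂ (deriv (theta m r)) {w | 0 < w.im} :=
    (differentiableOn_theta hm r).deriv isOpen_upperHalfPlaneSet
  exact mdifferentiable_of_differentiableOn
    (((differentiableOn_theta hm m).mul (h 0)).sub ((differentiableOn_theta hm 0).mul (h m)))

/-! ### Behaviour of the theta constants at infinity -/

lemma one_le_sq_of_ne_zero {n : ℤ} (hn : n ≠ 0) : 1 ≤ n ^ 2 :=
  Int.add_one_le_iff.2 (sq_pos_iff.2 hn)

lemma tendsto_theta_one_zero : Tendsto (fun τ : ℍ ↦ theta 1 0 τ) atImInfty (𝓝 1) := by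
  have h := tendsto_atImInfty_of_hasSum_cexp (δ := 2 * π) (by positivity) {0}
    (fun τ : ℍ ↦ hasSum_theta one_ne_zero 0 τ.im_pos) (by simp) (fun n hn _ ↦ ?_)
  · simpa using h
  · have : (1 : ℝ) ≤ (n : ℝ) ^ 2 := mod_cast one_le_sq_of_ne_zero (by simpa using hn)
    simp
    nlinarith [Real.pi_pos]

lemma tendsto_deriv_theta_one_zero :
    Tendsto (fun τ : ℍ ↦ deriv (theta 1 0) τ) atImInfty (𝓝 0) := by
  have h := tendsto_atImInfty_of_hasSum_cexp (δ := 2 * π) (by positivity) {0}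
    (fun τ : ℍ ↦ hasSum_deriv_theta one_ne_zero 0 τ.im_pos) (by simp) (fun n hn _ ↦ ?_)
  · simpa using h
  · have : (1 : ℝ) ≤ (n : ℝ) ^ 2 := mod_cast one_le_sq_of_ne_zero (by simpa using hn)
    simp
    nlinarith [Real.pi_pos]

lemma two_pi_le_two_pi_mul (n : ℤ) (hn : n ∉ ({0, -1} : Finset ℤ)) :
    2 * π ≤ 2 * π * (n * (n + 1)) := by
  have : (1 : ℝ) ≤ n * (n + 1) := by
    simp only [Finset.mem_insert, Finset.mem_singleton, not_or] at hn
    have : 1 ≤ n * (n + 1) := by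
      rcases lt_or_ge n 0 with h | h
      · nlinarith [show n ≤ -2 by omega]
      · nlinarith [show 1 ≤ n by omega]
    exact_mod_cast this
  nlinarith [Real.pi_pos]

lemma tendsto_theta_one_one :
    Tendsto (fun τ : ℍ ↦ theta 1 1 τ * cexp (-(2 * π * I * (τ / 4)))) atImInfty (𝓝 2) := by
  have h := tendsto_atImInfty_of_hasSum_cexp (c := fun _ : ℤ ↦ 1)
    (y := fun n : ℤ ↦ 2 * π * (n * (n + 1))) (δ := 2 * π) (by positivity) {0, -1}
    (fun τ : ℍ ↦ ((hasSum_theta one_ne_zero 1 τ.im_pos).mul_right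
      (cexp (-(2 * π * I * (τ / 4))))).congr_fun fun n ↦ ?_) (by simp)
    (fun n hn _ ↦ two_pi_le_two_pi_mul n hn)
  · simpa [one_add_one_eq_two] using h
  · conv_rhs => rw [mul_assoc, ← Complex.exp_add]
    push_cast
    ring_nf

lemma tendsto_deriv_theta_one_one :
    Tendsto (fun τ : ℍ ↦ deriv (theta 1 1) τ * cexp (-(2 * π * I * (τ / 4)))) atImInfty
      (𝓝 (π * I)) := by
  have h := tendsto_atImInfty_of_hasSum_cexp (c := fun n : ℤ ↦ I * (2 * π * (n + 1 / 2) ^ 2))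
    (y := fun n : ℤ ↦ 2 * π * (n * (n + 1))) (δ := 2 * π) (by positivity) {0, -1}
    (fun τ : ℍ ↦ ((hasSum_deriv_theta one_ne_zero 1 τ.im_pos).mul_right
      (cexp (-(2 * π * I * (τ / 4))))).congr_fun fun n ↦ ?_) (by simp)
    (fun n hn _ ↦ two_pi_le_two_pi_mul n hn)
  · convert! h using 2
    rw [Finset.sum_pair (by norm_num)]
    push_cast
    ring
  · rw [mul_assoc (1 * _), ← Complex.exp_add]
    push_cast
    ring_nf

lemma tendsto_theta_one_one_zero : Tendsto (fun τ : ℍ ↦ theta 1 1 τ) atImInfty (𝓝 0) := by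
  have h := tendsto_atImInfty_of_hasSum_cexp (δ := π / 2) (by positivity) ∅
    (fun τ : ℍ ↦ hasSum_theta one_ne_zero 1 τ.im_pos) (by simp) (fun n _ _ ↦ ?_)
  · simpa using h
  · have : (1 : ℝ) ≤ (2 * n + 1) ^ 2 :=
      mod_cast one_le_sq_of_ne_zero (show 2 * n + 1 ≠ 0 by omega)
    push_cast
    nlinarith [Real.pi_pos]

theorem xiStar_one_eq (τ : ℍ) : xiStar 1 τ = -(π * I) * η τ ^ 6 := by
  refine eq_const_mul_eta_pow_six (mdifferentiable_xiStar one_ne_zero)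
    (fun τ ↦ ?_) (fun τ ↦ ?_) ?_ τ
  · have h := xiStar_one_smul (isThetaMultiplier_T_zpow 1) τ
    have hdet : (!![1, 0; 0, cexp (2 * π * I * ((1 : ℤ) / 4))]).det = I := by
      rw [Matrix.det_fin_two_of, Int.cast_one, cexp_two_pi_I_div_four]
      ring
    rwa [autFactor_T_zpow, one_pow, mul_one, zpow_one, show Matrix.det _ = I from hdet] at h
  · have h := xiStar_one_smul isThetaMultiplier_S τ
    rwa [autFactor_S, show Matrix.det _ = I from det_thetaMultiplier_S] at h
  · have h := (tendsto_theta_one_one.mul tendsto_deriv_theta_one_zero).sub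
      (tendsto_theta_one_zero.mul tendsto_deriv_theta_one_one)
    rw [mul_zero, one_mul, zero_sub] at h
    refine h.congr fun τ ↦ ?_
    rw [xiStar]
    ring

lemma theta_one_neg_one_div (r : ℕ) {τ : ℂ} (hτ : 0 < τ.im) :
    theta 1 r (-1 / τ) =
      (-I / 2) ^ (1 / 2 : ℂ) * τ ^ (1 / 2 : ℂ) * (theta 1 0 τ + (-1) ^ r * theta 1 1 τ) := by
  simpa [theta] using thetaJ_one_neg_one_div r hτ 0

theorem theta_one_zero_mul_theta_one_one (τ : ℍ) :
    theta 1 0 τ * theta 1 1 τ * (theta 1 0 τ ^ 4 - theta 1 1 τ ^ 4) = 2 * η τ ^ 6 := by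
  have hd := differentiableOn_theta one_ne_zero
  refine eq_const_mul_eta_pow_six (V := fun τ ↦ theta 1 0 τ * theta 1 1 τ *
      (theta 1 0 τ ^ 4 - theta 1 1 τ ^ 4)) (mdifferentiable_of_differentiableOn
      (((hd 0).mul (hd 1)).mul (((hd 0).pow 4).sub ((hd 1).pow 4)))) (fun τ ↦ ?_) (fun τ ↦ ?_) ?_ τ
  · have h0 : theta 1 0 ((τ : ℂ) + 1) = theta 1 0 τ := by
      simpa [theta] using thetaJ_add_intCast one_ne_zero 0 1 τ 0
    have h1 : theta 1 1 ((τ : ℂ) + 1) = I * theta 1 1 τ := by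
      simpa [theta, ← one_div, cexp_two_pi_I_div_four] using
        thetaJ_add_intCast one_ne_zero 1 1 τ 0
    simp only [coe_T_smul, h0, h1, mul_pow, I_pow_four]
    ring
  · simp only [coe_S_smul, theta_one_neg_one_div _ τ.im_pos]
    set s := (-I / 2) ^ (1 / 2 : ℂ) * (τ : ℂ) ^ (1 / 2 : ℂ) with hs
    have hs2 : s ^ 2 = -I / 2 * τ := by rw [hs, mul_pow, cpow_half_sq, cpow_half_sq]
    have hs6 : s ^ 6 = I * τ ^ 3 / 8 := by
      rw [pow_mul s 2 3, hs2]
      linear_combination (-I * τ ^ 3 / 8) * I_sq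
    linear_combination (8 * theta 1 0 τ * theta 1 1 τ *
      (theta 1 0 τ ^ 4 - theta 1 1 τ ^ 4)) * hs6
  · have h := (tendsto_theta_one_zero.mul tendsto_theta_one_one).mul
      ((tendsto_theta_one_zero.pow 4).sub (tendsto_theta_one_one_zero.pow 4))
    norm_num at h
    refine h.congr fun τ ↦ ?_
    ring

/-- The point `m τ` of the upper half-plane. -/
def scale (m : ℕ) (hm : m ≠ 0) (τ : ℍ) : ℍ := ⟨m * τ, by
  have : 0 < m := Nat.pos_of_ne_zero hm
  rw [← ofReal_natCast, im_ofReal_mul]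
  exact mul_pos (mod_cast this) τ.im_pos⟩

lemma coe_scale {m : ℕ} (hm : m ≠ 0) (τ : ℍ) : (scale m hm τ : ℂ) = m * τ := rfl

lemma theta_zero_eq (m : ℕ) (τ : ℂ) : theta m 0 τ = theta 1 0 (m * τ) := by
  rw [theta, thetaJ_zero_eq, mul_zero, theta]

lemma theta_self_eq {m : ℕ} (hm : m ≠ 0) (τ : ℂ) : theta m m τ = theta 1 1 (m * τ) := by
  rw [theta, thetaJ_self_eq hm, mul_zero, theta]

lemma theta_one_ne_zero (τ : ℍ) : theta 1 0 τ ≠ 0 ∧ theta 1 1 τ ≠ 0 := by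
  have h : theta 1 0 τ * theta 1 1 τ * (theta 1 0 τ ^ 4 - theta 1 1 τ ^ 4) ≠ 0 := by
    rw [theta_one_zero_mul_theta_one_one]
    exact mul_ne_zero two_ne_zero (pow_ne_zero 6 (eta_ne_zero τ.2))
  exact mul_ne_zero_iff.1 (left_ne_zero_of_mul h)

lemma theta_zero_ne_zero {m : ℕ} (hm : m ≠ 0) (τ : ℍ) : theta m 0 τ ≠ 0 := by
  rw [theta_zero_eq]
  exact (theta_one_ne_zero (scale m hm τ)).1

lemma theta_self_ne_zero {m : ℕ} (hm : m ≠ 0) (τ : ℍ) : theta m m τ ≠ 0 := by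
  rw [theta_self_eq hm]
  exact (theta_one_ne_zero (scale m hm τ)).2

lemma xiStar_eq_mul_xiStar_one {m : ℕ} (hm : m ≠ 0) (τ : ℍ) :
    xiStar m τ = m * xiStar 1 (scale m hm τ) := by
  rw [xiStar, funext (theta_zero_eq m), funext (theta_self_eq hm), deriv_comp_mul_left,
    deriv_comp_mul_left, xiStar, coe_scale, smul_eq_mul, smul_eq_mul]
  ring

theorem xiStar_eq {m : ℕ} (hm : m ≠ 0) (τ : ℍ) :
    xiStar m τ = -(π * I * m * η (m * (τ : ℂ)) ^ 6) := by
  rw [xiStar_eq_mul_xiStar_one hm, xiStar_one_eq, coe_scale]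
  ring

lemma xiStar_ne_zero {m : ℕ} (hm : m ≠ 0) (τ : ℍ) : xiStar m τ ≠ 0 := by
  have hη : η (m * τ) ≠ 0 := eta_ne_zero (scale m hm τ).2
  rw [xiStar_eq hm]
  simp [hm, hη]

lemma exists_thetaWedge_ne_zero (τ : ℍ) : ∃ z, thetaWedge τ z ≠ 0 := by
  by_contra! h
  have h2 := iteratedDeriv_two_thetaWedge τ
  rw [show thetaWedge τ = fun _ ↦ 0 from funext h] at h2
  simp [xiStar_ne_zero one_ne_zero] at h2

/-! ### The operator `D₂` -/

/-- Joint holomorphy of a function on `ℍ × ℂ`, the first variable being extended to `ℂ` by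
`ofComplex`. -/
def IsJointlyHolomorphic (φ : ℍ → ℂ → ℂ) : Prop :=
  DifferentiableOn ℂ (fun p : ℂ × ℂ ↦ φ (ofComplex p.1) p.2) {p | 0 < p.1.im}

lemma hasDerivAt_autFactor_ofComplex (g : SL(2, ℤ)) (τ : ℍ) :
    HasDerivAt (fun w : ℂ ↦ autFactor g (ofComplex w)) (g 1 0) τ := by
  have h : HasDerivAt (fun w : ℂ ↦ (g 1 0 : ℂ) * w + g 1 1) (g 1 0) τ := by
    simpa using ((hasDerivAt_id' (τ : ℂ)).const_mul (g 1 0 : ℂ)).add_const (g 1 1 : ℂ)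
  refine h.congr_of_eventuallyEq ?_
  filter_upwards [eventuallyEq_coe_comp_ofComplex τ.im_pos] with w hw
  exact congrArg (fun u : ℂ ↦ (g 1 0 : ℂ) * u + g 1 1) hw

lemma hasDerivAt_coe_smul_ofComplex (g : SL(2, ℤ)) (τ : ℍ) :
    HasDerivAt (fun w : ℂ ↦ ((g • ofComplex w : ℍ) : ℂ)) (autFactor g τ ^ 2)⁻¹ τ := by
  have hnum : HasDerivAt (fun w : ℂ ↦ (g 0 0 : ℂ) * w + g 0 1) (g 0 0) τ := by
    simpa using ((hasDerivAt_id' (τ : ℂ)).const_mul (g 0 0 : ℂ)).add_const (g 0 1 : ℂ)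
  have hden := hasDerivAt_autFactor_ofComplex g τ
  have hdiv := hnum.fun_div hden (by simpa using autFactor_ne_zero g τ)
  refine (hdiv.congr_of_eventuallyEq ?_).congr_deriv ?_
  · filter_upwards [eventuallyEq_coe_comp_ofComplex τ.im_pos] with w hw
    rw [coe_smul_eq, show (ofComplex w : ℂ) = w from hw]
  · rw [ofComplex_apply, ← one_div]
    congr 1
    simp only [autFactor]
    linear_combination det_eq_one g

section Holomorphic

variable {φ ψ : ℍ → ℂ → ℂ}

lemma IsJointlyHolomorphic.differentiableAt (hφ : IsJointlyHolomorphic φ) {w : ℂ} (hw : 0 < w.im)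
    (z : ℂ) : DifferentiableAt ℂ (fun p : ℂ × ℂ ↦ φ (ofComplex p.1) p.2) (w, z) :=
  DifferentiableOn.differentiableAt hφ
    ((isOpen_upperHalfPlaneSet.preimage continuous_fst).mem_nhds hw)

lemma IsJointlyHolomorphic.differentiable (hφ : IsJointlyHolomorphic φ) (τ : ℍ) :
    Differentiable ℂ (φ τ) := fun z ↦ by
  have h := DifferentiableAt.comp z (f := fun z ↦ ((τ : ℂ), z))
    (g := fun p : ℂ × ℂ ↦ φ (ofComplex p.1) p.2) (hφ.differentiableAt τ.im_pos z) (by fun_prop)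
  simpa [Function.comp_def] using h

lemma IsJointlyHolomorphic.differentiableAt_ofComplex (hφ : IsJointlyHolomorphic φ) (z : ℂ)
    {w : ℂ} (hw : 0 < w.im) : DifferentiableAt ℂ (fun w : ℂ ↦ φ (ofComplex w) z) w :=
  DifferentiableAt.comp w (f := fun w ↦ (w, z))
    (g := fun p : ℂ × ℂ ↦ φ (ofComplex p.1) p.2) (hφ.differentiableAt hw z) (by fun_prop)

lemma heatOperator_add (k : ℕ) (a : ℂ) (hφ : IsJointlyHolomorphic φ)
    (hψ : IsJointlyHolomorphic ψ) :
    heatOperator k a (φ + ψ) = heatOperator k a φ + heatOperator k a ψ := by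
  ext τ
  have h1 : (fun z : ℂ ↦ (φ + ψ) τ z) = φ τ + ψ τ := rfl
  have h2 : (fun w : ℂ ↦ (φ + ψ) (ofComplex w) 0) =
    (fun w : ℂ ↦ φ (ofComplex w) 0) + fun w : ℂ ↦ ψ (ofComplex w) 0 := rfl
  rw [heatOperator, h1, h2, deriv_add (hφ.differentiableAt_ofComplex 0 τ.im_pos)
    (hψ.differentiableAt_ofComplex 0 τ.im_pos), iteratedDeriv_add
    ((hφ.differentiable τ).contDiff.contDiffAt) ((hψ.differentiable τ).contDiff.contDiffAt)]
  simp only [Pi.add_apply, heatOperator]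
  ring

lemma heatOperator_smul (k : ℕ) (a c : ℂ) (φ : ℍ → ℂ → ℂ) :
    heatOperator k a (c • φ) = c • heatOperator k a φ := by
  ext τ
  have h1 : (fun z : ℂ ↦ (c • φ) τ z) = fun z ↦ c * φ τ z := rfl
  have h2 : (fun w : ℂ ↦ (c • φ) (ofComplex w) 0) = fun w : ℂ ↦ c * φ (ofComplex w) 0 := rfl
  rw [heatOperator, h1, h2, deriv_const_mul_field, iteratedDeriv_const_mul_field, Pi.smul_apply,
    heatOperator, smul_eq_mul]
  ring

lemma heatOperator_of_apply_zero (k : ℕ) (a : ℂ) (h : ∀ τ, φ τ 0 = 0) (τ : ℍ) :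
    heatOperator k a φ τ = k / (2 * π * I) * iteratedDeriv 2 (φ τ) 0 := by
  simp [heatOperator, h]

lemma hasDerivAt_jacobiSlash_zero (k : ℤ) (m : ℕ) (g : SL(2, ℤ)) (hφ : IsJointlyHolomorphic φ)
    (τ : ℍ) : HasDerivAt (fun w : ℂ ↦ jacobiSlash k m g φ (ofComplex w) 0)
      (-k * autFactor g τ ^ (-k - 1) * g 1 0 * φ (g • τ) 0 + autFactor g τ ^ (-k) *
        (deriv (fun w : ℂ ↦ φ (ofComplex w) 0) (g • τ : ℍ) / autFactor g τ ^ 2)) τ := by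
  have hslash : (fun w : ℂ ↦ jacobiSlash k m g φ (ofComplex w) 0) = fun w ↦
      autFactor g (ofComplex w) ^ (-k) * φ (ofComplex (g • ofComplex w : ℍ)) 0 := by
    ext w
    simp [jacobiSlash]
  have hfactor : HasDerivAt (fun w : ℂ ↦ autFactor g (ofComplex w) ^ (-k))
      ((-k : ℤ) * autFactor g τ ^ (-k - 1) * g 1 0) τ := by
    simpa only [ofComplex_apply, Function.comp_def] using HasDerivAt.comp
      (h₂ := fun x : ℂ ↦ x ^ (-k)) (τ : ℂ)
      (hasDerivAt_zpow (-k) _ (Or.inl (autFactor_ne_zero g _))) (hasDerivAt_autFactor_ofComplex g τ)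
  have hφ' : HasDerivAt (fun w : ℂ ↦ φ (ofComplex w) 0)
      (deriv (fun w : ℂ ↦ φ (ofComplex w) 0) (g • τ : ℍ)) ((g • ofComplex τ : ℍ) : ℂ) := by
    rw [ofComplex_apply]
    exact (hφ.differentiableAt_ofComplex 0 (g • τ).im_pos).hasDerivAt
  rw [hslash]
  refine (hfactor.fun_mul (hφ'.comp (τ : ℂ) (hasDerivAt_coe_smul_ofComplex g τ))).congr_deriv ?_
  simp only [ofComplex_apply, Function.comp_apply]
  push_cast
  ring

lemma D₂_jacobiSlash (k m : ℕ) (g : SL(2, ℤ)) (hφ : IsJointlyHolomorphic φ) :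
    D₂ k m (jacobiSlash k m g φ) = (D₂ k m φ) ∣[(k + 2 : ℤ)] g := by
  ext τ
  have hj := autFactor_ne_zero g τ
  have h1 : (fun z : ℂ ↦ jacobiSlash k m g φ τ z) = fun z ↦ autFactor g τ ^ (-k : ℤ) *
      (cexp (-(2 * π * I * m * g 1 0 / autFactor g τ) * z ^ 2) *
        (fun z ↦ φ (g • τ) (z / autFactor g τ)) z) := by
    ext z
    simp only [jacobiSlash]
    ring_nf
  have hF : Differentiable ℂ fun z ↦ φ (g • τ) (z / autFactor g τ) :=
    (hφ.differentiable (g • τ)).comp (by fun_prop)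
  rw [slash_apply_autFactor, D₂, heatOperator, h1, iteratedDeriv_const_mul_field,
    iteratedDeriv_two_cexp_mul hF, iteratedDeriv_two_comp_div (hφ.differentiable _),
    (hasDerivAt_jacobiSlash_zero k m g hφ τ).deriv, D₂, heatOperator, zero_div,
    zpow_sub_one₀ hj, neg_add, zpow_add₀ hj (-(k : ℤ)) (-2)]
  rw [show (-2 : ℤ) = -((2 : ℕ) : ℤ) from rfl, zpow_neg _ ((2 : ℕ) : ℤ), zpow_natCast]
  push_cast
  field_simp
  ring

end Holomorphic

lemma nonneg_of_coeff_ne_zero {m M : ℕ} {c : ℤ → ℤ → ℂ} (hm : m ≠ 0)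
    (hc : ∀ n r : ℤ, 4 * m * n < M * r ^ 2 → c n r = 0) {n r : ℤ} (h : c n r ≠ 0) : 0 ≤ n := by
  have h1 : (M : ℤ) * r ^ 2 ≤ 4 * m * n := not_lt.1 fun h' ↦ h (hc n r h')
  have h2 : 0 ≤ (M : ℤ) * r ^ 2 := by positivity
  have h3 : (0 : ℤ) < 4 * m := by positivity
  nlinarith

lemma eq_zero_of_coeff_ne_zero {m M : ℕ} {c : ℤ → ℤ → ℂ} (hM : M ≠ 0)
    (hc : ∀ n r : ℤ, 4 * m * n < M * r ^ 2 → c n r = 0) {r : ℤ} (h : c 0 r ≠ 0) : r = 0 := by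
  by_contra hr
  have := sq_pos_iff.2 hr
  exact h (hc 0 r (by rw [mul_zero]; positivity))

theorem hasSum_heatOperator {ι : Type*} {c : ι → ℂ} {x y : ι → ℝ} {F : ℍ → ℂ → ℂ}
    (hy : ∀ i, c i ≠ 0 → 0 ≤ y i)
    (hF : ∀ (τ : ℍ) (z : ℂ),
      HasSum (fun i ↦ c i * cexp (I * y i * τ) * cexp (I * x i * z)) (F τ z))
    (k : ℕ) (a : ℂ) (τ : ℍ) :
    HasSum (fun i ↦ (k / (2 * π * I) * (I * x i) ^ 2 - a * (I * y i)) * c i * cexp (I * y i * τ))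
      (heatOperator k a F τ) := by
  have hF₀ (w : ℂ) (hw : 0 < w.im) :
      HasSum (fun i ↦ c i * cexp (I * y i * w)) (F (ofComplex w) 0) := by
    simpa [ofComplex_apply_of_im_pos hw] using hF ⟨w, hw⟩ 0
  have hz := hasSum_iteratedDeriv_tsum_cexp (fun z ↦ (hF τ z).summable) 2
  simp only [fun z ↦ (hF τ z).tsum_eq] at hz
  have hτ := hasSum_deriv_tsum_cexp hy (fun w hw ↦ (hF₀ w hw).summable) τ.im_pos
  have hev : (fun w ↦ ∑' i, c i * cexp (I * y i * w)) =ᶠ[𝓝 (τ : ℂ)] fun w ↦ F (ofComplex w) 0 := by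
    filter_upwards [isOpen_upperHalfPlaneSet.mem_nhds τ.im_pos] with w hw using (hF₀ w hw).tsum_eq
  rw [hev.deriv_eq] at hτ
  refine ((hz.mul_left (k / (2 * π * I))).sub (hτ.mul_left a)).congr_fun fun i ↦ ?_
  ring

lemma HasJacobiExpansion.hasSum_D₂ {k m M : ℕ} (hm : m ≠ 0) (hM : M ≠ 0) {F : ℍ → ℂ → ℂ}
    (hF : HasJacobiExpansion m M F) :
    ∃ d : ℤ × ℤ → ℂ, (∀ p, d p ≠ 0 → 2 * π / M ≤ 2 * π * p.1 / M) ∧ ∀ τ : ℍ,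
      HasSum (fun p ↦ d p * cexp (I * (2 * π * p.1 / M : ℝ) * τ)) (D₂ k m F τ) := by
  obtain ⟨c, hc, hs⟩ := hF
  have hn (p : ℤ × ℤ) (hp : c p.1 p.2 ≠ 0) : 0 ≤ p.1 := nonneg_of_coeff_ne_zero hm hc hp
  have hF (τ : ℍ) (z : ℂ) : HasSum (fun p : ℤ × ℤ ↦ c p.1 p.2 *
      cexp (I * (2 * π * p.1 / M : ℝ) * τ) * cexp (I * (2 * π * p.2 : ℝ) * z)) (F τ z) := by
    refine (hs τ z).congr_fun fun p ↦ ?_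
    rw [mul_assoc, ← Complex.exp_add]
    push_cast
    ring_nf
  refine ⟨fun p ↦ (k / (2 * π * I) * (I * (2 * π * p.2 : ℝ)) ^ 2 -
    2 * m * (I * (2 * π * p.1 / M : ℝ))) * c p.1 p.2, fun p hp ↦ ?_,
    hasSum_heatOperator (fun p hp ↦ ?_) hF k (2 * m)⟩
  · have hcp : c p.1 p.2 ≠ 0 := right_ne_zero_of_mul hp
    have hp1 : p.1 ≠ 0 := fun h1 ↦ by
      have h2 : p.2 = 0 := eq_zero_of_coeff_ne_zero hM hc (h1 ▸ hcp)
      simp [h1, h2] at hp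
    have hp1' : (1 : ℝ) ≤ p.1 := mod_cast (hn p hcp).lt_of_ne' hp1
    exact div_le_div_of_nonneg_right (le_mul_of_one_le_right Real.two_pi_pos.le hp1')
      (Nat.cast_nonneg M)
  · have : (0 : ℝ) ≤ p.1 := mod_cast hn p hp
    positivity

lemma HasJacobiExpansion.mdifferentiable_D₂ {k m M : ℕ} (hm : m ≠ 0) (hM : M ≠ 0) {F : ℍ → ℂ → ℂ}
    (hF : HasJacobiExpansion m M F) : MDiff (D₂ k m F) := by
  obtain ⟨d, hd, hs⟩ := hF.hasSum_D₂ (k := k) hm hM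
  have h := differentiableOn_tsum_cexp (c := d) (y := fun p ↦ 2 * π * p.1 / M)
    (fun p hp ↦ (by positivity : 0 ≤ 2 * π / M).trans (hd p hp))
    (fun w hw ↦ (hs ⟨w, hw⟩).summable)
  convert! mdifferentiable_of_differentiableOn h using 1
  ext τ
  exact (hs τ).tsum_eq.symm

lemma HasJacobiExpansion.isZeroAtImInfty_D₂ {k m M : ℕ} (hm : m ≠ 0) (hM : M ≠ 0)
    {F : ℍ → ℂ → ℂ} (hF : HasJacobiExpansion m M F) : IsZeroAtImInfty (D₂ k m F) := by
  obtain ⟨d, hd, hs⟩ := hF.hasSum_D₂ (k := k) hm hM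
  have h := tendsto_atImInfty_of_hasSum_cexp (δ := 2 * π / M) (by positivity) ∅ hs (by simp)
    (fun p _ hp ↦ hd p hp)
  rwa [Finset.sum_empty] at h

lemma jacobiSlash_one (k : ℤ) (m : ℕ) (φ : ℍ → ℂ → ℂ) : jacobiSlash k m 1 φ = φ := by
  ext τ z
  simp [jacobiSlash, autFactor]

lemma jacobiSlash_eq_smul {k : ℤ} {m M : ℕ} {χ : DirichletCharacter ℂ M} {φ : ℍ → ℂ → ℂ}
    {γ : Gamma0 M} (hφ : ∀ (τ : ℍ) (z : ℂ), φ (γ.1 • τ) (z / autFactor γ.1 τ) =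
      nebentypus χ γ * autFactor γ.1 τ ^ k *
        cexp (2 * π * I * m * ((γ.1 1 0 : ℂ) * z ^ 2 / autFactor γ.1 τ)) * φ τ z) :
    jacobiSlash k m γ.1 φ = nebentypus χ γ • φ := by
  ext τ z
  have hj := autFactor_ne_zero γ.1 τ
  rw [jacobiSlash, hφ τ z]
  simp only [Pi.smul_apply, smul_eq_mul]
  have e : autFactor γ.1 τ ^ (-k) * autFactor γ.1 τ ^ k = 1 := by
    rw [← zpow_add₀ hj, neg_add_cancel, zpow_zero]
  rw [Complex.exp_neg]
  field_simp [Complex.exp_ne_zero]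
  linear_combination nebentypus χ γ * φ τ z * e

theorem D₂_mem_cuspForms {k m M : ℕ} (hm : m ≠ 0) (hM : M ≠ 0) {χ : DirichletCharacter ℂ M}
    {φ : ℍ → ℂ → ℂ} (hφ : φ ∈ jacobiForms k m M χ) :
    D₂ k m φ ∈ cuspForms (k + 2) M (nebentypus χ) := by
  have hol : IsJointlyHolomorphic φ := hφ.1
  have hzero (g : SL(2, ℤ)) : IsZeroAtImInfty ((D₂ k m φ) ∣[(k + 2 : ℤ)] g) := by
    rw [← D₂_jacobiSlash k m g hol]
    exact (hφ.2.2.2 g).isZeroAtImInfty_D₂ hm hM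
  refine ⟨⟨?_, fun γ τ ↦ ?_, fun g ↦ (hzero g).isBoundedAtImInfty⟩, hzero⟩
  · have := (hφ.2.2.2 1).mdifferentiable_D₂ (k := k) hm hM
    rwa [jacobiSlash_one] at this
  · have hj := autFactor_ne_zero γ.1 τ
    have h := congrFun (D₂_jacobiSlash k m γ.1 hol) τ
    rw [jacobiSlash_eq_smul (hφ.2.1 γ), D₂, heatOperator_smul, ← D₂, slash_apply_autFactor,
      zpow_neg, Pi.smul_apply, smul_eq_mul] at h
    have hjk := zpow_ne_zero (k + 2 : ℤ) hj
    field_simp at h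
    linear_combination -h

/-! ### Scaling by `m` -/

lemma exists_eq_mul_upperTriangular {A : Matrix (Fin 2) (Fin 2) ℤ} (hA : 0 < A.det) :
    ∃ (g : SL(2, ℤ)) (a d : ℕ) (b : ℤ), 0 < a ∧ 0 < d ∧ A = g * !![(a : ℤ), b; 0, d] := by
  let P (B : FixedDetMatrix (Fin 2) ℤ A.det) : Prop :=
    ∃ (g : SL(2, ℤ)) (a d : ℕ) (b : ℤ), 0 < a ∧ 0 < d ∧ B.1 = g * !![(a : ℤ), b; 0, d]
  have hmul (h : SL(2, ℤ)) (B : FixedDetMatrix (Fin 2) ℤ A.det) : P B → P (h • B) := by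
    rintro ⟨g, a, d, b, ha, hd, hB⟩
    refine ⟨h * g, a, d, b, ha, hd, ?_⟩
    rw [FixedDetMatrices.smul_coe, hB, Matrix.SpecialLinearGroup.coe_mul, mul_assoc]
  refine FixedDetMatrices.induction_on (C := P) (A := ⟨A, rfl⟩) hA.ne' (fun B h₁₀ h₀₀ _ _ ↦ ?_)
    (hmul _) (hmul _)
  have hdet : B.1.det = B.1 0 0 * B.1 1 1 := by
    rw [Matrix.det_fin_two, h₁₀, mul_zero, sub_zero]
  have h₁₁ : 0 < B.1 1 1 := pos_of_mul_pos_right (hA.trans_eq (B.2.symm.trans hdet)) h₀₀.le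
  refine ⟨1, (B.1 0 0).toNat, (B.1 1 1).toNat, B.1 0 1, by omega, by omega, ?_⟩
  rw [Int.toNat_of_nonneg h₀₀.le, Int.toNat_of_nonneg h₁₁.le, ← h₁₀,
    Matrix.SpecialLinearGroup.coe_one, one_mul]
  exact Matrix.eta_fin_two B.1

/-- The factorization `diag(m, 1) g = g' (a, b; 0, d)`, which reduces the behaviour of `F(mτ)` at
the cusp `g ∞` to that of `F` at the cusp `g' ∞`. -/
structure IsScaleFactorization (m : ℕ) (g g' : SL(2, ℤ)) (a d : ℕ) (b : ℤ) : Prop where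
  left_pos : 0 < a
  right_pos : 0 < d
  diag_mul : !![(m : ℤ), 0; 0, 1] * (g : Matrix (Fin 2) (Fin 2) ℤ) = g' * !![(a : ℤ), b; 0, d]

lemma exists_isScaleFactorization {m : ℕ} (hm : m ≠ 0) (g : SL(2, ℤ)) :
    ∃ (g' : SL(2, ℤ)) (a d : ℕ) (b : ℤ), IsScaleFactorization m g g' a d b := by
  obtain ⟨g', a, d, b, ha, hd, h⟩ := exists_eq_mul_upperTriangular
    (A := !![(m : ℤ), 0; 0, 1] * (g : Matrix (Fin 2) (Fin 2) ℤ)) (by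
      rw [Matrix.det_mul, g.det_coe, Matrix.det_fin_two_of]
      simpa using Nat.pos_of_ne_zero hm)
  exact ⟨g', a, d, b, ha, hd, h⟩

lemma im_mul_add_div (a d : ℕ) (b : ℤ) (w : ℂ) : ((a * w + b) / d).im = a * w.im / d := by
  rw [div_natCast_im]
  simp

/-- The point `(a τ + b) / d` of the upper half-plane. -/
def affinePoint {a d : ℕ} (ha : 0 < a) (hd : 0 < d) (b : ℤ) (τ : ℍ) : ℍ :=
  ⟨(a * τ + b) / d, by
    rw [im_mul_add_div]
    have := τ.im_pos
    positivity⟩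

lemma coe_affinePoint {a d : ℕ} (ha : 0 < a) (hd : 0 < d) (b : ℤ) (τ : ℍ) :
    (affinePoint ha hd b τ : ℂ) = (a * τ + b) / d := rfl

lemma im_affinePoint {a d : ℕ} (ha : 0 < a) (hd : 0 < d) (b : ℤ) (τ : ℍ) :
    (affinePoint ha hd b τ).im = a * τ.im / d := im_mul_add_div a d b τ

lemma tendsto_affinePoint_atImInfty {a d : ℕ} (ha : 0 < a) (hd : 0 < d) (b : ℤ) :
    Tendsto (affinePoint ha hd b) atImInfty atImInfty := by
  have had : (0 : ℝ) < a / d := by positivity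
  refine tendsto_comap_iff.2 ((tendsto_comap.const_mul_atTop had).congr fun τ ↦ ?_)
  rw [Function.comp_apply, im_affinePoint]
  ring

namespace IsScaleFactorization

variable {m a d : ℕ} {b : ℤ} {g g' : SL(2, ℤ)}

lemma mul_eq (h : IsScaleFactorization m g g' a d b) : a * d = m := by
  have hdet := congrArg Matrix.det h.diag_mul
  simp only [Matrix.det_mul, Matrix.SpecialLinearGroup.det_coe, Matrix.det_fin_two_of, mul_one,
    mul_zero, sub_zero, one_mul] at hdet
  exact_mod_cast hdet.symm

lemma entries (h : IsScaleFactorization m g g' a d b) :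
    (m : ℂ) * g 0 0 = g' 0 0 * a ∧ (m : ℂ) * g 0 1 = g' 0 0 * b + g' 0 1 * d ∧
      (g 1 0 : ℂ) = g' 1 0 * a ∧ (g 1 1 : ℂ) = g' 1 0 * b + g' 1 1 * d := by
  have entry (i j : Fin 2) := congrArg (fun A : Matrix (Fin 2) (Fin 2) ℤ ↦ A i j) h.diag_mul
  simp only [Matrix.mul_apply, Fin.sum_univ_two] at entry
  have h₀₀ := entry 0 0
  have h₀₁ := entry 0 1
  have h₁₀ := entry 1 0
  have h₁₁ := entry 1 1
  simp only [Matrix.of_apply, Matrix.cons_val', Matrix.cons_val_zero, Matrix.cons_val_one,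
    Matrix.cons_val_fin_one, zero_mul, mul_zero, add_zero, zero_add, one_mul] at h₀₀ h₀₁ h₁₀ h₁₁
  exact ⟨mod_cast h₀₀, mod_cast h₀₁, mod_cast h₁₀, mod_cast h₁₁⟩

lemma autFactor_eq (h : IsScaleFactorization m g g' a d b) (τ : ℍ) :
    autFactor g τ = autFactor g' (affinePoint h.left_pos h.right_pos b τ) * d := by
  have hd : (d : ℂ) ≠ 0 := mod_cast h.right_pos.ne'
  obtain ⟨-, -, h₁₀, h₁₁⟩ := h.entries
  simp only [autFactor, coe_affinePoint, h₁₀, h₁₁]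
  field_simp
  ring

lemma coe_smul_affinePoint (h : IsScaleFactorization m g g' a d b) (τ : ℍ) :
    ((g' • affinePoint h.left_pos h.right_pos b τ : ℍ) : ℂ) = m * (g • τ : ℍ) := by
  have hd : (d : ℂ) ≠ 0 := mod_cast h.right_pos.ne'
  have hj := autFactor_ne_zero g' (affinePoint h.left_pos h.right_pos b τ)
  obtain ⟨h₀₀, h₀₁, -, -⟩ := h.entries
  rw [coe_smul_eq, coe_smul_eq, h.autFactor_eq, coe_affinePoint]
  field_simp
  linear_combination (-τ : ℂ) * h₀₀ - h₀₁

lemma thetaWedge_smul (h : IsScaleFactorization m g g' a d b)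
    {U : Matrix (Fin (2 * 1)) (Fin (2 * 1)) ℂ} (hU : IsThetaMultiplier 1 g' U) (τ : ℍ) (z : ℂ) :
    thetaWedge (m * (g • τ : ℍ)) (m * (z / autFactor g τ)) =
      U.det / d * autFactor g τ * cexp (2 * π * I * m * ((g 1 0 : ℂ) * z ^ 2 / autFactor g τ)) *
        thetaWedge (affinePoint h.left_pos h.right_pos b τ) (a * z) := by
  have hd : (d : ℂ) ≠ 0 := mod_cast h.right_pos.ne'
  have hj := autFactor_ne_zero g' (affinePoint h.left_pos h.right_pos b τ)
  have had : (a : ℂ) * d = m := mod_cast h.mul_eq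
  obtain ⟨-, -, h₁₀, -⟩ := h.entries
  have harg : (m * (z / autFactor g τ) : ℂ) =
      a * z / autFactor g' (affinePoint h.left_pos h.right_pos b τ) := by
    rw [h.autFactor_eq, ← had]
    field_simp
  have hexp : 2 * π * I * m * ((g 1 0 : ℂ) * z ^ 2 / autFactor g τ) = 2 * π * I * ((g' 1 0 : ℂ) *
      (a * z) ^ 2 / autFactor g' (affinePoint h.left_pos h.right_pos b τ)) := by
    rw [h.autFactor_eq, ← had, h₁₀]
    field_simp
  rw [harg, hexp, ← h.coe_smul_affinePoint, JacobiRestriction.thetaWedge_smul hU, h.autFactor_eq]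
  field_simp

end IsScaleFactorization

lemma isScaleFactorization_conjLevel {m : ℕ} (hm : m ≠ 0) (γ : Gamma0 m) :
    IsScaleFactorization m γ.1 (conjLevel m γ) m 1 0 := by
  have hdvd : (m : ℤ) ∣ γ.1 1 0 := (ZMod.intCast_zmod_eq_zero_iff_dvd _ m).1 (Gamma0_mem.1 γ.2)
  refine ⟨Nat.pos_of_ne_zero hm, one_pos, ?_⟩
  ext i j
  fin_cases i <;> fin_cases j <;>
    simp [conjLevel, Matrix.mul_apply, Fin.sum_univ_two, mul_comm, Int.mul_ediv_cancel' hdvd]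

/-! ### The multiplier `ω_m` -/

lemma isThetaMultiplier_thetaMultiplier (γ : SL(2, ℤ)) :
    IsThetaMultiplier 1 γ (thetaMultiplier 1 γ) :=
  Classical.epsilon_spec ((exists_isThetaMultiplier γ).imp fun _ h ↦ h.1)

lemma det_eq_of_isThetaMultiplier {γ : SL(2, ℤ)} {U V : Matrix (Fin (2 * 1)) (Fin (2 * 1)) ℂ}
    (hU : IsThetaMultiplier 1 γ U) (hV : IsThetaMultiplier 1 γ V) : U.det = V.det := by
  have h := (xiStar_one_smul hU UpperHalfPlane.I).symm.trans (xiStar_one_smul hV UpperHalfPlane.I)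
  have h1 := pow_ne_zero 3 (autFactor_ne_zero γ UpperHalfPlane.I)
  exact mul_right_cancel₀ h1 (mul_right_cancel₀ (xiStar_ne_zero one_ne_zero _) h)

lemma norm_det_thetaMultiplier (γ : SL(2, ℤ)) : ‖(thetaMultiplier 1 γ).det‖ = 1 := by
  obtain ⟨U, hU, h⟩ := exists_isThetaMultiplier γ
  rw [← h, det_eq_of_isThetaMultiplier hU (isThetaMultiplier_thetaMultiplier γ)]

lemma omega_mul_conj (m : ℕ) (γ : Gamma0 m) : omega m γ * starRingEnd ℂ (omega m γ) = 1 := by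
  rw [Complex.mul_conj, Complex.normSq_eq_norm_sq, omega, norm_det_thetaMultiplier]
  simp

lemma thetaWedge_Gamma0_smul {m : ℕ} (hm : m ≠ 0) (γ : Gamma0 m) (τ : ℍ) (z : ℂ) :
    thetaWedge (m * (γ.1 • τ : ℍ)) (m * (z / autFactor γ.1 τ)) =
      omega m γ * autFactor γ.1 τ *
        cexp (2 * π * I * m * ((γ.1 1 0 : ℂ) * z ^ 2 / autFactor γ.1 τ)) *
          thetaWedge (m * τ) (m * z) := by
  have h := (isScaleFactorization_conjLevel hm γ).thetaWedge_smul
    (isThetaMultiplier_thetaMultiplier _) τ z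
  rw [h, coe_affinePoint, omega]
  simp

/-! ### Jacobi forms with two theta components -/

/-- The function `f (θ_{m,m} θ^J_{m,0} - θ_{m,0} θ^J_{m,m})`, written through the index-one wedge;
see `isThetaDecomposition_starForm`. -/
def starForm (m : ℕ) (f : ℍ → ℂ) (τ : ℍ) (z : ℂ) : ℂ := f τ * thetaWedge (m * τ) (m * z)

lemma starForm_zero (m : ℕ) (f : ℍ → ℂ) (τ : ℍ) : starForm m f τ 0 = 0 := by
  rw [starForm, mul_zero, thetaWedge_zero, mul_zero]

lemma starForm_injective {m : ℕ} (hm : m ≠ 0) : Function.Injective (starForm m) := by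
  intro f f' h
  ext τ
  obtain ⟨z, hz⟩ := exists_thetaWedge_ne_zero (scale m hm τ)
  have h1 := congrFun (congrFun h τ) (z / m)
  have hm' : (m : ℂ) ≠ 0 := mod_cast hm
  simp only [starForm, mul_div_cancel₀ z hm', ← coe_scale hm] at h1
  exact mul_right_cancel₀ hz h1

lemma D₂_starForm (k : ℕ) {m : ℕ} (hm : m ≠ 0) (f : ℍ → ℂ) (τ : ℍ) :
    D₂ k m (starForm m f) τ = 4 * m * k * xiStar m τ * f τ := by
  have hm' : (m : ℂ) ≠ 0 := mod_cast hm
  have h1 : starForm m f τ = fun z ↦ f τ * thetaWedge (scale m hm τ) (z / (m : ℂ)⁻¹) := by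
    ext z
    rw [starForm, coe_scale, div_inv_eq_mul, mul_comm z]
  rw [D₂, heatOperator_of_apply_zero _ _ (starForm_zero m f), h1, iteratedDeriv_const_mul_field,
    iteratedDeriv_two_comp_div (differentiable_thetaWedge (scale m hm τ).im_pos),
    iteratedDeriv_two_thetaWedge, xiStar_eq_mul_xiStar_one hm]
  field_simp [Real.pi_ne_zero]
  ring

lemma IsScaleFactorization.jacobiSlash_starForm {m a d : ℕ} {b : ℤ} {g g' : SL(2, ℤ)}
    (h : IsScaleFactorization m g g' a d b) (k : ℤ) (f : ℍ → ℂ) (τ : ℍ) (z : ℂ) :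
    jacobiSlash k m g (starForm m f) τ z = (thetaMultiplier 1 g').det / d * (f ∣[(k - 1)] g) τ *
      thetaWedge (affinePoint h.left_pos h.right_pos b τ) (a * z) := by
  have hj := autFactor_ne_zero g τ
  rw [jacobiSlash, starForm, h.thetaWedge_smul (isThetaMultiplier_thetaMultiplier _),
    slash_apply_autFactor, show -(k - 1) = -k + 1 by ring, zpow_add_one₀ hj, Complex.exp_neg]
  field_simp [Complex.exp_ne_zero]

lemma isThetaDecomposition_starForm {m : ℕ} (hm : m ≠ 0) (f : ℍ → ℂ) :
    IsThetaDecomposition m (starForm m f) fun r τ ↦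
      if r = 0 then f τ * theta m m τ else if r = m then -(f τ * theta m 0 τ) else 0 := by
  intro τ z
  rw [Finset.sum_eq_add_of_mem 0 m (Finset.mem_range.2 (by omega)) (Finset.mem_range.2 (by omega))
    hm.symm (fun r _ hr ↦ by simp [hr.1, hr.2])]
  simp only [if_true, if_neg hm, starForm, thetaWedge_mul hm]
  ring

lemma fourierMode_thetaJ {m : ℕ} (hm : m ≠ 0) {τ : ℂ} (hτ : 0 < τ.im) {b : ℕ} (hb : b ≠ 0)
    {r j : ℕ} (hr : r < 2 * m) (hj : j < 2 * m) :
    fourierMode (b * j) (fun z ↦ thetaJ m r τ (b * z)) =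
      if r = j then cexp (2 * π * I * (j ^ 2 * τ / (4 * m))) else 0 := by
  have hiff (n : ℤ) : (2 * m * n + r) * b = b * j ↔ 2 * m * n + r = j := by
    rw [mul_comm]
    exact mul_right_inj' (mod_cast hb)
  have h := hasSum_fourierMode_thetaJ hm r hτ b (b * j)
  simp only [hiff] at h
  refine (h.unique (hasSum_single (0 : ℤ) fun n hn ↦ if_neg fun hnj ↦ hn ?_)).trans ?_
  · have hr' : (r : ℤ) < 2 * m := mod_cast hr
    have hj' : (j : ℤ) < 2 * m := mod_cast hj
    refine Int.abs_lt_one_iff.1 ?_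
    by_contra! hn'
    rcases le_abs.1 hn' with hpos | hneg <;> nlinarith [hr', hj']
  · simp only [mul_zero, zero_add, Int.cast_zero, Nat.cast_inj]
    split_ifs with h
    · rw [h]
    · rfl

lemma fourierMode_finset_sum {ι : Type*} (s : Finset ι) (F : ι → ℂ → ℂ)
    (hF : ∀ i ∈ s, Continuous (F i)) (a : ℤ) :
    fourierMode a (fun z ↦ ∑ i ∈ s, F i z) = ∑ i ∈ s, fourierMode a (F i) := by
  simp only [fourierMode, Finset.sum_mul]
  refine intervalIntegral.integral_finsetSum fun i hi ↦ Continuous.intervalIntegrable ?_ _ _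
  have := hF i hi
  fun_prop

lemma continuous_thetaJ {m : ℕ} (hm : m ≠ 0) (r : ℕ) {τ : ℂ} (hτ : 0 < τ.im) :
    Continuous (thetaJ m r τ) :=
  Differentiable.continuous (𝕜 := ℂ) fun z ↦ differentiableAt_thetaJ_snd hm r hτ z

lemma IsThetaDecomposition.fourierMode_eq {m : ℕ} (hm : m ≠ 0) {φ : ℍ → ℂ → ℂ} {h : ℕ → ℍ → ℂ}
    (hd : IsThetaDecomposition m φ h) {j : ℕ} (hj : j < 2 * m) (τ : ℍ) :
    fourierMode j (φ τ) = h j τ * cexp (2 * π * I * (j ^ 2 * τ / (4 * m))) := by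
  rw [show φ τ = _ from funext (hd τ), fourierMode_finset_sum _ _ fun r _ ↦
    (continuous_thetaJ hm r τ.im_pos).const_mul _]
  have hmode {r : ℕ} (hr : r < 2 * m) : fourierMode j (fun z ↦ thetaJ m r τ z) =
      if r = j then cexp (2 * π * I * (j ^ 2 * τ / (4 * m))) else 0 := by
    simpa using fourierMode_thetaJ hm τ.im_pos one_ne_zero hr hj
  simp only [fourierMode_const_mul]
  rw [Finset.sum_eq_single_of_mem j (Finset.mem_range.2 hj), hmode hj, if_pos rfl]
  intro r hr hne
  rw [hmode (Finset.mem_range.1 hr), if_neg hne, mul_zero]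

lemma IsThetaDecomposition.eq {m : ℕ} (hm : m ≠ 0) {φ : ℍ → ℂ → ℂ} {h h' : ℕ → ℍ → ℂ}
    (hd : IsThetaDecomposition m φ h) (hd' : IsThetaDecomposition m φ h') {j : ℕ}
    (hj : j < 2 * m) : h j = h' j := by
  ext τ
  exact mul_right_cancel₀ (Complex.exp_ne_zero _)
    ((hd.fourierMode_eq hm hj τ).symm.trans (hd'.fourierMode_eq hm hj τ))

lemma exists_eq_starForm {k : ℤ} {m N : ℕ} (hm : m ≠ 0) {χ : DirichletCharacter ℂ (m * N)}
    {φ : ℍ → ℂ → ℂ} (hφ : φ ∈ jacobiStarKernel k m N χ) : ∃ f, φ = starForm m f := by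
  obtain ⟨-, ⟨h, hd, hv⟩, h0⟩ := hφ
  have hφ' (τ : ℍ) (z : ℂ) : φ τ z = h 0 τ * thetaJ m 0 τ z + h m τ * thetaJ m m τ z := by
    rw [hd τ z, Finset.sum_eq_add_of_mem 0 m (Finset.mem_range.2 (by omega))
      (Finset.mem_range.2 (by omega)) hm.symm]
    intro r hr hne
    rw [hv r (Finset.mem_range.1 hr) hne.1 hne.2]
    simp
  refine ⟨fun τ ↦ h 0 τ / theta m m τ, funext₂ fun τ z ↦ ?_⟩
  have hθ := theta_self_ne_zero hm τ
  have hzero : h 0 τ * theta m 0 τ + h m τ * theta m m τ = 0 := (hφ' τ 0).symm.trans (h0 τ)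
  rw [starForm, thetaWedge_mul hm, hφ']
  field_simp
  linear_combination thetaJ m m τ z * hzero

section

variable {m N : ℕ} {χ : DirichletCharacter ℂ (m * N)} {f : ℍ → ℂ}

lemma starForm_transform_iff (hm : m ≠ 0) (k : ℤ) (γ : Gamma0 (m * N)) (τ : ℍ) :
    (∀ z, starForm m f (γ.1 • τ) (z / autFactor γ.1 τ) = nebentypus χ γ * autFactor γ.1 τ ^ k *
      cexp (2 * π * I * m * ((γ.1 1 0 : ℂ) * z ^ 2 / autFactor γ.1 τ)) * starForm m f τ z) ↔
    f (γ.1 • τ) = twistedNebentypus m χ γ * autFactor γ.1 τ ^ (k - 1) * f τ := by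
  have hj := autFactor_ne_zero γ.1 τ
  have hw (z : ℂ) := thetaWedge_Gamma0_smul hm ⟨γ.1, Gamma0_mul_le m N γ.2⟩ τ z
  have hω := omega_mul_conj m ⟨γ.1, Gamma0_mul_le m N γ.2⟩
  simp only [starForm, twistedNebentypus, hw]
  set ω := omega m ⟨γ.1, Gamma0_mul_le m N γ.2⟩
  set ω' := starRingEnd ℂ ω
  rw [show autFactor γ.1 τ ^ k = autFactor γ.1 τ ^ (k - 1) * autFactor γ.1 τ by
    rw [← zpow_add_one₀ hj, sub_add_cancel]]
  constructor
  · intro h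
    obtain ⟨z, hz⟩ := exists_thetaWedge_ne_zero (scale m hm τ)
    have hz' := h (z / m)
    rw [mul_div_cancel₀ z (mod_cast hm), ← coe_scale hm] at hz'
    have he := Complex.exp_ne_zero (2 * π * I * m * ((γ.1 1 0 : ℂ) * (z / m) ^ 2 / autFactor γ.1 τ))
    have hfω : f (γ.1 • τ) * ω = nebentypus χ γ * autFactor γ.1 τ ^ (k - 1) * f τ := by
      refine mul_right_cancel₀ (mul_ne_zero (mul_ne_zero hj he) hz) ?_
      linear_combination hz'
    linear_combination ω' * hfω - f (γ.1 • τ) * hω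
  · intro h z
    rw [h]
    linear_combination (nebentypus χ γ * autFactor γ.1 τ ^ (k - 1) * f τ * autFactor γ.1 τ *
      cexp (2 * π * I * m * ((γ.1 1 0 : ℂ) * z ^ 2 / autFactor γ.1 τ)) *
        thetaWedge (m * τ) (m * z)) * hω

lemma mdifferentiable_of_starForm_mem {k : ℕ} (hk : k ≠ 0) (hm : m ≠ 0) (hN : N ≠ 0)
    (hφ : starForm m f ∈ jacobiForms k m (m * N) χ) : MDiff f := by
  have hk' : (k : ℂ) ≠ 0 := mod_cast hk
  have hm' : (m : ℂ) ≠ 0 := mod_cast hm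
  have hD := UpperHalfPlane.mdifferentiable_iff.1 (D₂_mem_cuspForms hm (mul_ne_zero hm hN) hφ).1.1
  have hξ := UpperHalfPlane.mdifferentiable_iff.1 (mdifferentiable_xiStar hm)
  refine UpperHalfPlane.mdifferentiable_iff.2 ((hD.div (hξ.const_mul (4 * m * k : ℂ))
    fun w _ ↦ ?_).congr fun w _ ↦ ?_)
  · simp [hk', hm', xiStar_ne_zero hm]
  · simp only [Pi.div_apply, Function.comp_apply, D₂_starForm k hm]
    field_simp [xiStar_ne_zero hm (ofComplex w)]

lemma fourierMode_sub {F G : ℂ → ℂ} (hF : Continuous F) (hG : Continuous G) (a : ℤ) :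
    fourierMode a (fun z ↦ F z - G z) = fourierMode a F - fourierMode a G := by
  simp only [fourierMode, sub_mul]
  exact intervalIntegral.integral_sub (Continuous.intervalIntegrable (by fun_prop) _ _)
    (Continuous.intervalIntegrable (by fun_prop) _ _)

lemma fourierMode_thetaWedge {a : ℕ} (ha : a ≠ 0) (τ : ℍ) :
    fourierMode a (fun z ↦ thetaWedge τ (a * z)) =
      -(theta 1 0 τ * cexp (2 * π * I * (τ / 4))) := by
  have hc (r : ℕ) : Continuous fun z : ℂ ↦ thetaJ 1 r τ (a * z) :=
    (continuous_thetaJ one_ne_zero r τ.im_pos).comp (by fun_prop)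
  have hmode {r : ℕ} (hr : r < 2 * 1) : fourierMode a (fun z ↦ thetaJ 1 r τ (a * z)) =
      if r = 1 then cexp (2 * π * I * (τ / 4)) else 0 := by
    simpa using fourierMode_thetaJ one_ne_zero τ.im_pos ha hr one_lt_two
  simp only [thetaWedge]
  rw [fourierMode_sub ((hc 0).const_mul _) ((hc 1).const_mul _), fourierMode_const_mul,
    fourierMode_const_mul, hmode two_pos, hmode one_lt_two, if_neg zero_ne_one, if_pos rfl,
    mul_zero, zero_sub]

lemma HasJacobiExpansion.exists_norm_fourierMode_le {M : ℕ} (hm : m ≠ 0) (hM : M ≠ 0)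
    {F : ℍ → ℂ → ℂ} (hF : HasJacobiExpansion m M F) (a : ℤ) :
    ∃ C, ∀ τ : ℍ, 1 ≤ τ.im →
      ‖fourierMode a (F τ)‖ ≤ C * Real.exp (-(2 * π * (a ^ 2 / (4 * m)) * τ.im)) := by
  obtain ⟨c, hc, hs⟩ := hF
  have hM0 : (0 : ℝ) < M := by positivity
  have h (τ : ℍ) : HasSum (fun p : ℤ × ℤ ↦ (if p.2 = a then c p.1 p.2 else 0) *
      cexp (I * (2 * π * p.1 / M : ℝ) * τ)) (fourierMode a (F τ)) := by
    have h1 := hasSum_fourierMode (A := fun p : ℤ × ℤ ↦ c p.1 p.2 *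
      cexp (I * (2 * π * p.1 / M : ℝ) * τ)) (r := fun p ↦ p.2) (F := F τ) (fun t ↦ ?_) a
    · exact h1.congr_fun fun p ↦ by split_ifs <;> simp
    · refine (hs τ t).congr_fun fun p ↦ ?_
      rw [mul_assoc, ← Complex.exp_add]
      push_cast
      ring_nf
  have hy (p : ℤ × ℤ) (hp : (if p.2 = a then c p.1 p.2 else 0) ≠ 0) :
      2 * π * (a ^ 2 / (4 * m)) ≤ 2 * π * p.1 / M := by
    obtain ⟨rfl, hcp⟩ := ite_ne_right_iff.1 hp
    have hle : (M : ℝ) * p.2 ^ 2 ≤ 4 * m * p.1 := mod_cast not_lt.1 (mt (hc p.1 p.2) hcp)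
    rw [mul_div_assoc]
    refine mul_le_mul_of_nonneg_left ?_ (by positivity)
    rw [div_le_div_iff₀ (by positivity) hM0]
    linarith
  obtain ⟨C, hC⟩ := exists_norm_le_of_hasSum_cexp hy (h UpperHalfPlane.I).summable
  exact ⟨C, fun τ hτ ↦ hC τ _ hτ (h τ)⟩

lemma IsScaleFactorization.norm_fourierMode_jacobiSlash_starForm {a d : ℕ} {b : ℤ}
    {g g' : SL(2, ℤ)} (h : IsScaleFactorization m g g' a d b) (k : ℤ) (f : ℍ → ℂ) (τ : ℍ) :
    ‖fourierMode a (jacobiSlash k m g (starForm m f) τ)‖ =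
      ‖(f ∣[(k - 1)] g) τ‖ / d * ‖theta 1 0 (affinePoint h.left_pos h.right_pos b τ)‖ *
        Real.exp (-(2 * π * (a ^ 2 / (4 * m)) * τ.im)) := by
  have ha : (0 : ℝ) < a := mod_cast h.left_pos
  have hd : (0 : ℝ) < d := mod_cast h.right_pos
  have hnorm : ‖cexp (2 * π * I * ((affinePoint h.left_pos h.right_pos b τ : ℂ) / 4))‖ =
      Real.exp (-(2 * π * (a ^ 2 / (4 * m)) * τ.im)) := by
    rw [show 2 * π * I * ((affinePoint h.left_pos h.right_pos b τ : ℂ) / 4) =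
      I * (2 * π / 4 : ℝ) * (affinePoint h.left_pos h.right_pos b τ : ℂ) by push_cast; ring,
      norm_cexp_I_mul, coe_im, im_affinePoint, ← h.mul_eq]
    congr 1
    push_cast
    field_simp
  rw [show jacobiSlash k m g (starForm m f) τ = _ from funext (h.jacobiSlash_starForm k f τ),
    fourierMode_const_mul, fourierMode_thetaWedge h.left_pos.ne', norm_mul, norm_mul, norm_neg,
    norm_mul, hnorm, norm_div, norm_det_thetaMultiplier, norm_natCast]
  ring

lemma isBoundedAtImInfty_slash_of_starForm {k : ℤ} (hm : m ≠ 0) (hN : N ≠ 0) (g : SL(2, ℤ))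
    (hexp : HasJacobiExpansion m (m * N) (jacobiSlash k m g (starForm m f))) :
    IsBoundedAtImInfty (f ∣[(k - 1)] g) := by
  obtain ⟨g', a, d, b, h⟩ := exists_isScaleFactorization hm g
  obtain ⟨C, hC⟩ := hexp.exists_norm_fourierMode_le hm (mul_ne_zero hm hN) a
  have hd : (0 : ℝ) < d := mod_cast h.right_pos
  have htheta : ∀ᶠ τ in atImInfty,
      1 / 2 < ‖theta 1 0 (affinePoint h.left_pos h.right_pos b τ)‖ :=
    ((tendsto_theta_one_zero.comp
      (tendsto_affinePoint_atImInfty h.left_pos h.right_pos b)).norm).eventually_const_lt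
        (by norm_num)
  have him : ∀ᶠ τ : ℍ in atImInfty, 1 ≤ τ.im := tendsto_comap.eventually_ge_atTop 1
  refine Asymptotics.IsBigO.of_bound (2 * d * C) ?_
  filter_upwards [htheta, him] with τ hθ hτ
  have hmode := hC τ hτ
  rw [h.norm_fourierMode_jacobiSlash_starForm] at hmode
  have hle : ‖(f ∣[(k - 1)] g) τ‖ / d * (1 / 2) ≤ C :=
    (mul_le_mul_of_nonneg_left hθ.le (by positivity)).trans
      (le_of_mul_le_mul_right hmode (Real.exp_pos _))
  rw [div_mul_eq_mul_div, div_le_iff₀ hd] at hle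
  rw [Pi.one_apply, norm_one, mul_one]
  linarith

theorem mem_modularForms_of_starForm_mem {k : ℕ} (hk : k ≠ 0) (hm : m ≠ 0) (hN : N ≠ 0)
    (hφ : starForm m f ∈ jacobiForms k m (m * N) χ) :
    f ∈ modularForms (k - 1) (m * N) (twistedNebentypus m χ) :=
  ⟨mdifferentiable_of_starForm_mem hk hm hN hφ,
    fun γ τ ↦ (starForm_transform_iff hm k γ τ).1 (hφ.2.1 γ τ),
    fun g ↦ isBoundedAtImInfty_slash_of_starForm hm hN g (hφ.2.2.2 g)⟩

end

/-! ### Fourier expansions of Jacobi forms -/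

section Expansion

variable {m M : ℕ} {F F' : ℍ → ℂ → ℂ}

lemma hasJacobiExpansion_of_hasSum {ι : Type*} (A : ι → ℂ) (n r : ι → ℤ)
    (hA : ∀ i, A i ≠ 0 → M * r i ^ 2 ≤ 4 * m * n i)
    (hF : ∀ (τ : ℍ) (z : ℂ), HasSum
      (fun i ↦ A i * cexp (2 * π * I * (n i * (τ : ℂ) / M + r i * z))) (F τ z)) :
    HasJacobiExpansion m M F := by
  let s (p : ℤ × ℤ) : Set ι := (fun i ↦ (n i, r i)) ⁻¹' {p}
  refine ⟨fun a b ↦ ∑' i : s (a, b), A i, fun a b hab ↦ ?_, fun τ z ↦ ?_⟩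
  · refine (tsum_congr fun i ↦ ?_).trans tsum_zero
    obtain ⟨h1, h2⟩ : n i = a ∧ r i = b := Prod.mk.inj i.2
    by_contra h
    have hle := hA i h
    rw [h1, h2] at hle
    exact hab.not_ge hle
  · refine ((hF τ z).tsum_fiberwise fun i ↦ (n i, r i)).congr_fun fun p ↦ ?_
    rw [← tsum_mul_right]
    refine tsum_congr fun i ↦ ?_
    obtain ⟨h1, h2⟩ : n i = p.1 ∧ r i = p.2 := Prod.mk.inj i.2
    rw [h1, h2]

lemma HasJacobiExpansion.sub (hF : HasJacobiExpansion m M F) (hF' : HasJacobiExpansion m M F') :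
    HasJacobiExpansion m M (F - F') := by
  obtain ⟨c, hc, hs⟩ := hF
  obtain ⟨c', hc', hs'⟩ := hF'
  refine ⟨c - c', fun n r h ↦ by simp [hc n r h, hc' n r h], fun τ z ↦ ?_⟩
  exact ((hs τ z).sub (hs' τ z)).congr_fun fun p ↦ by simp [sub_mul]

lemma HasJacobiExpansion.const_smul (a : ℂ) (hF : HasJacobiExpansion m M F) :
    HasJacobiExpansion m M (a • F) := by
  obtain ⟨c, hc, hs⟩ := hF
  refine ⟨a • c, fun n r h ↦ by simp [hc n r h], fun τ z ↦ ?_⟩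
  exact ((hs τ z).mul_left a).congr_fun fun p ↦ by simp [mul_assoc]

lemma periodic_comp_ofComplex {E : Type*} {f : ℍ → E} {t : ℝ} (hf : ∀ τ, f (t +ᵥ τ) = f τ) :
    Function.Periodic (f ∘ ofComplex) t := by
  intro w
  rw [Function.comp_apply, Function.comp_apply]
  by_cases! hw : 0 < w.im
  · have hw' : 0 < (w + t).im := by simpa using hw
    rw [ofComplex_apply_of_im_pos hw', ofComplex_apply_of_im_pos hw, ← hf ⟨w, hw⟩]
    congr 1
    ext
    simp [add_comm]
  · have hw' : (w + t).im ≤ 0 := by simpa using hw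
    rw [ofComplex_apply_eq_of_im_nonpos hw' hw]

lemma isBoundedAtImInfty_mul_cexp {f : ℍ → ℂ} (hf : IsBoundedAtImInfty f) {y : ℝ} (hy : 0 ≤ y) :
    IsBoundedAtImInfty fun τ ↦ f τ * cexp (I * y * τ) := by
  refine hf.mul (Asymptotics.IsBigO.of_bound 1 (.of_forall fun τ ↦ ?_))
  rw [norm_cexp_I_mul, Pi.one_apply, norm_one, mul_one, Real.exp_le_one_iff, neg_nonpos]
  exact mul_nonneg hy τ.im_pos.le

lemma isZeroAtImInfty_mul_cexp {f : ℍ → ℂ} (hf : IsBoundedAtImInfty f) {y : ℝ} (hy : 0 < y) :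
    IsZeroAtImInfty fun τ ↦ f τ * cexp (I * y * τ) := by
  have hexp : Tendsto (fun τ : ℍ ↦ cexp (I * y * τ)) atImInfty (𝓝 0) := by
    rw [tendsto_zero_iff_norm_tendsto_zero]
    simp only [norm_cexp_I_mul]
    exact Real.tendsto_exp_neg_atTop_nhds_zero.comp (tendsto_comap.const_mul_atTop hy)
  have hf' : f =O[atImInfty] fun _ ↦ (1 : ℂ) :=
    hf.trans (Asymptotics.isBigO_of_le _ fun _ ↦ by simp)
  have h := hf'.mul_isLittleO ((Asymptotics.isLittleO_one_iff ℂ).2 hexp)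
  rw [mul_one] at h
  exact (Asymptotics.isLittleO_one_iff ℂ).1 h

lemma hasSum_qExpansion_cexp {H : ℍ → ℂ} (hM : M ≠ 0) (hper : ∀ τ, H ((M : ℝ) +ᵥ τ) = H τ)
    (hH : MDiff H) (hb : IsBoundedAtImInfty H) (τ : ℍ) :
    HasSum (fun j : ℕ ↦ (qExpansion M H).coeff j * cexp (2 * π * I * (j * τ / M))) (H τ) := by
  refine (hasSum_qExpansion (by positivity) (periodic_comp_ofComplex hper) hH hb τ).congr_fun
    fun j ↦ ?_
  rw [smul_eq_mul, Function.Periodic.qParam, ← Complex.exp_nat_mul]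
  push_cast
  ring_nf

lemma exists_hasSum_mul_cexp (hM : M ≠ 0) {f : ℍ → ℂ} (hf : MDiff f) (hb : IsBoundedAtImInfty f)
    {x : ℝ} (hx : 0 ≤ x) (hper : ∀ τ, f ((M : ℝ) +ᵥ τ) * cexp (2 * π * I * x) = f τ) :
    ∃ c : ℕ → ℂ, (c 0 ≠ 0 → x = 0) ∧ ∀ τ : ℍ,
      HasSum (fun j ↦ c j * cexp (2 * π * I * (j * τ / M)))
        (f τ * cexp (2 * π * I * (x * τ / M))) := by
  have hMC : (M : ℂ) ≠ 0 := mod_cast hM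
  -- The twist by `exp (2πi x τ / M)` turns the multiplier of `f` into an honest period `M`.
  let H : ℍ → ℂ := fun τ ↦ f τ * cexp (I * (2 * π * x / M : ℝ) * τ)
  have hH (τ : ℍ) : H τ = f τ * cexp (2 * π * I * (x * τ / M)) := by
    simp only [H]
    push_cast
    ring_nf
  have hHper (τ : ℍ) : H ((M : ℝ) +ᵥ τ) = H τ := by
    rw [hH, hH, ← hper τ, mul_assoc (f _), ← Complex.exp_add, coe_vadd]
    congr 2
    push_cast
    field_simp
  have hHd : MDiff H := hf.mul (mdifferentiable_of_differentiableOn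
    (F := fun w ↦ cexp (I * (2 * π * x / M : ℝ) * w)) (by fun_prop))
  have hHb : IsBoundedAtImInfty H := isBoundedAtImInfty_mul_cexp hb (by positivity)
  refine ⟨fun j ↦ (qExpansion M H).coeff j, fun h₀ ↦ ?_, fun τ ↦ ?_⟩
  · contrapose! h₀
    have hH₀ : IsZeroAtImInfty H := isZeroAtImInfty_mul_cexp hb (by positivity)
    have hHper' := periodic_comp_ofComplex hHper
    rw [qExpansion_coeff_zero (by positivity)
      (analyticAt_cuspFunction_zero (by positivity) hHper' hHd hHb) hHper',
      hH₀.valueAtInfty_eq_zero]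
  · rw [← hH]
    exact hasSum_qExpansion_cexp hM hHper hHd hHb τ

lemma exists_hasSum_of_isBoundedAtImInfty (hM : M ≠ 0) {f : ℍ → ℂ} (hf : MDiff f)
    (hb : IsBoundedAtImInfty f) {t : ℕ}
    (hper : ∀ τ, f ((M : ℝ) +ᵥ τ) * cexp (2 * π * I * (t / 4)) = f τ) :
    ∃ (n : ℕ → ℕ) (c : ℕ → ℂ), (∀ j, c j ≠ 0 → t ≤ 4 * n j) ∧ ∀ τ : ℍ,
      HasSum (fun j ↦ c j * cexp (2 * π * I * (n j * τ / M)))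
        (f τ * cexp (2 * π * I * (t * τ / (4 * M)))) := by
  obtain ⟨s, r, hr, rfl⟩ : ∃ s r, r < 4 ∧ t = 4 * s + r :=
    ⟨t / 4, t % 4, Nat.mod_lt _ (by norm_num), (Nat.div_add_mod t 4).symm⟩
  have hper' (τ : ℍ) : f ((M : ℝ) +ᵥ τ) * cexp (2 * π * I * (r / 4 : ℝ)) = f τ := by
    rw [← hper τ, ← cexp_add_two_pi_I_intCast _ s]
    push_cast
    ring_nf
  obtain ⟨c, hc, hsum⟩ := exists_hasSum_mul_cexp hM hf hb (by positivity) hper'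
  refine ⟨(· + s), c, fun j hj ↦ show 4 * s + r ≤ 4 * (j + s) from ?_, fun τ ↦ ?_⟩
  · rcases Nat.eq_zero_or_pos j with rfl | hj0
    · have hr0 : r = 0 := by simpa using hc hj
      omega
    · omega
  · have htwist : f τ * cexp (2 * π * I * ((4 * s + r : ℕ) * τ / (4 * M))) =
        f τ * cexp (2 * π * I * ((r / 4 : ℝ) * τ / M)) * cexp (2 * π * I * (s * τ / M)) := by
      rw [mul_assoc (f τ), ← Complex.exp_add]
      push_cast
      ring_nf
    rw [htwist]
    refine ((hsum τ).mul_right _).congr_fun fun j ↦ ?_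
    rw [mul_assoc (c j), ← Complex.exp_add]
    push_cast
    ring_nf

end Expansion

lemma jacobiSlash_mul (k : ℤ) (m : ℕ) (γ δ : SL(2, ℤ)) (φ : ℍ → ℂ → ℂ) :
    jacobiSlash k m (γ * δ) φ = jacobiSlash k m δ (jacobiSlash k m γ φ) := by
  ext τ z
  simp only [jacobiSlash]
  rw [jacobi_exponent_mul, autFactor_mul, mul_zpow, mul_add, neg_add, Complex.exp_add, mul_smul,
    mul_comm (autFactor γ (δ • τ)), ← div_div]
  ring

lemma jacobiSlash_T_zpow (k : ℤ) (m : ℕ) (n : ℤ) (φ : ℍ → ℂ → ℂ) (τ : ℍ) (z : ℂ) :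
    jacobiSlash k m (ModularGroup.T ^ n) φ τ z = φ ((n : ℝ) +ᵥ τ) z := by
  rw [jacobiSlash, autFactor_T_zpow, modular_T_zpow_smul]
  simp [ModularGroup.coe_T_zpow]

lemma jacobiSlash_vadd {k : ℤ} {m M : ℕ} {χ : DirichletCharacter ℂ M} {φ : ℍ → ℂ → ℂ}
    (hφ : ∀ (γ : Gamma0 M) (τ : ℍ) (z : ℂ), φ (γ.1 • τ) (z / autFactor γ.1 τ) =
      nebentypus χ γ * autFactor γ.1 τ ^ k *
        cexp (2 * π * I * m * ((γ.1 1 0 : ℂ) * z ^ 2 / autFactor γ.1 τ)) * φ τ z)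
    (g : SL(2, ℤ)) (τ : ℍ) (z : ℂ) :
    jacobiSlash k m g φ ((M : ℝ) +ᵥ τ) z = jacobiSlash k m g φ τ z := by
  have hT : ModularGroup.T ^ (M : ℤ) ∈ CongruenceSubgroup.Gamma M := by
    simpa using ModularGroup_T_pow_mem_Gamma M M dvd_rfl
  have hγ : g * ModularGroup.T ^ (M : ℤ) * g⁻¹ ∈ CongruenceSubgroup.Gamma M :=
    (CongruenceSubgroup.Gamma_normal (N := M)).conj_mem _ hT g
  obtain ⟨-, -, h₁₀, h₁₁⟩ := Gamma_mem.1 hγ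
  have hconj : jacobiSlash k m (g * ModularGroup.T ^ (M : ℤ) * g⁻¹) φ = φ := by
    have h := jacobiSlash_eq_smul (hφ ⟨_, Gamma0_mem.2 h₁₀⟩)
    rwa [nebentypus, h₁₁, map_one, one_smul] at h
  have hslash : jacobiSlash k m (ModularGroup.T ^ (M : ℤ)) (jacobiSlash k m g φ) =
      jacobiSlash k m g φ := by
    rw [← jacobiSlash_mul, ← inv_mul_cancel_right (g * _) g, jacobiSlash_mul, hconj]
  have h := congrFun₂ hslash τ z
  rwa [jacobiSlash_T_zpow, Int.cast_natCast] at h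

section

variable {m N a d : ℕ} {b : ℤ} {g g' : SL(2, ℤ)} {χ : DirichletCharacter ℂ (m * N)} {f : ℍ → ℂ}

lemma IsScaleFactorization.coe_affinePoint_vadd (h : IsScaleFactorization m g g' a d b) (N : ℕ)
    (τ : ℍ) : (affinePoint h.left_pos h.right_pos b (((m * N : ℕ) : ℝ) +ᵥ τ) : ℂ) =
      affinePoint h.left_pos h.right_pos b τ + (a ^ 2 * N : ℕ) := by
  have hd : (d : ℂ) ≠ 0 := mod_cast h.right_pos.ne'
  rw [coe_affinePoint, coe_affinePoint, coe_vadd, ← h.mul_eq]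
  push_cast
  field_simp
  ring

lemma IsScaleFactorization.slash_vadd_mul (h : IsScaleFactorization m g g' a d b) {k : ℤ}
    (hφ : ∀ (γ : Gamma0 (m * N)) (τ : ℍ) (z : ℂ),
      starForm m f (γ.1 • τ) (z / autFactor γ.1 τ) = nebentypus χ γ * autFactor γ.1 τ ^ k *
        cexp (2 * π * I * m * ((γ.1 1 0 : ℂ) * z ^ 2 / autFactor γ.1 τ)) * starForm m f τ z)
    (τ : ℍ) : (f ∣[(k - 1)] g) (((m * N : ℕ) : ℝ) +ᵥ τ) *
      cexp (2 * π * I * ((a ^ 2 * N : ℕ) / 4)) = (f ∣[(k - 1)] g) τ := by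
  have ha : (a : ℂ) ≠ 0 := mod_cast h.left_pos.ne'
  have hd : (d : ℂ) ≠ 0 := mod_cast h.right_pos.ne'
  have hdet : (thetaMultiplier 1 g').det ≠ 0 := by
    rw [← norm_ne_zero_iff, norm_det_thetaMultiplier]
    exact one_ne_zero
  obtain ⟨z, hz⟩ := exists_thetaWedge_ne_zero (affinePoint h.left_pos h.right_pos b τ)
  have hwedge := thetaWedge_add_intCast (a ^ 2 * N : ℕ) (affinePoint h.left_pos h.right_pos b τ) z
  rw [Int.cast_natCast] at hwedge
  have hslash := jacobiSlash_vadd hφ g τ (z / a)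
  rw [h.jacobiSlash_starForm, h.jacobiSlash_starForm, mul_div_cancel₀ z ha,
    h.coe_affinePoint_vadd, hwedge] at hslash
  refine mul_left_cancel₀ (div_ne_zero hdet hd) (mul_right_cancel₀ hz ?_)
  linear_combination hslash

lemma hasSum_mul_prod {ι κ : Type*} {A : ι → ℂ} {B : κ → ℂ} {x y : ℂ} (hA : HasSum A x)
    (hB : HasSum B y) : HasSum (fun p : ι × κ ↦ A p.1 * B p.2) (x * y) :=
  hA.mul hB (summable_mul_of_summable_norm hA.summable.norm hB.summable.norm)

lemma hasSum_thetaJ_mul_thetaJ {w : ℂ} (hw : 0 < w.im) (z z' : ℂ) :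
    HasSum (fun p : ℤ × ℤ ↦ cexp (2 * π * I * ((p.1 ^ 2 + (p.2 ^ 2 + p.2) : ℤ) * w +
        ((2 * p.1 : ℤ) * z + (2 * p.2 + 1 : ℤ) * z'))))
      (thetaJ 1 0 w z * (cexp (-(2 * π * I * (w / 4))) * thetaJ 1 1 w z')) := by
  refine (hasSum_mul_prod (hasSum_thetaJ one_ne_zero 0 hw z)
    ((hasSum_thetaJ one_ne_zero 1 hw z').mul_left _)).congr_fun fun p ↦ ?_
  rw [← Complex.exp_add, ← Complex.exp_add]
  push_cast
  ring_nf

lemma IsScaleFactorization.hasJacobiExpansion_mul (h : IsScaleFactorization m g g' a d b)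
    (hN : N ≠ 0) {G : ℍ → ℂ} {n : ℕ → ℕ} {c : ℕ → ℂ} (hc : ∀ j, c j ≠ 0 → a ^ 2 * N ≤ 4 * n j)
    (hG : ∀ τ : ℍ, HasSum (fun j ↦ c j * cexp (2 * π * I * (n j * τ / (m * N : ℕ)))) (G τ))
    {Q : ℂ → ℂ → ℂ} {κ ρ : ℤ × ℤ → ℤ} (hκ : ∀ p, ρ p ^ 2 ≤ 4 * κ p + 1)
    (hQ : ∀ (w : ℂ), 0 < w.im → ∀ z : ℂ,
      HasSum (fun p ↦ cexp (2 * π * I * (κ p * w + ρ p * z))) (Q w z)) :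
    HasJacobiExpansion m (m * N)
      fun τ z ↦ G τ * Q (affinePoint h.left_pos h.right_pos b τ) (a * z) := by
  have hN' : (N : ℂ) ≠ 0 := mod_cast hN
  have ha : (a : ℂ) ≠ 0 := mod_cast h.left_pos.ne'
  have hd : (d : ℂ) ≠ 0 := mod_cast h.right_pos.ne'
  have hm : (m : ℂ) = a * d := mod_cast h.mul_eq.symm
  refine hasJacobiExpansion_of_hasSum
    (fun p : ℕ × (ℤ × ℤ) ↦ c p.1 * cexp (2 * π * I * (κ p.2 * b / d)))
    (fun p ↦ n p.1 + κ p.2 * (a ^ 2 * N : ℕ)) (fun p ↦ a * ρ p.2) (fun p hp ↦ ?_) fun τ z ↦ ?_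
  · have hn : ((a ^ 2 * N : ℕ) : ℤ) ≤ 4 * n p.1 := mod_cast hc p.1 (left_ne_zero_of_mul hp)
    calc ((m * N : ℕ) : ℤ) * (a * ρ p.2) ^ 2 = m * ((a ^ 2 * N : ℕ) * ρ p.2 ^ 2) := by
          push_cast
          ring
      _ ≤ m * ((a ^ 2 * N : ℕ) * (4 * κ p.2 + 1)) := by gcongr; exact hκ p.2
      _ ≤ m * (4 * (n p.1 + κ p.2 * (a ^ 2 * N : ℕ))) :=
          mul_le_mul_of_nonneg_left (by linarith) (Int.natCast_nonneg m)
      _ = 4 * m * (n p.1 + κ p.2 * (a ^ 2 * N : ℕ)) := by ring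
  · refine (hasSum_mul_prod (hG τ)
      (hQ _ (affinePoint h.left_pos h.right_pos b τ).im_pos (a * z))).congr_fun fun p ↦ ?_
    rw [mul_assoc (c p.1), mul_assoc (c p.1), ← Complex.exp_add, ← Complex.exp_add, coe_affinePoint]
    congr 2
    push_cast
    rw [hm]
    field_simp
    ring

lemma IsScaleFactorization.cexp_mul_cexp_neg_affinePoint (h : IsScaleFactorization m g g' a d b)
    (hN : N ≠ 0) (τ : ℍ) :
    cexp (2 * π * I * ((a ^ 2 * N : ℕ) * τ / (4 * (m * N : ℕ)))) *
      cexp (-(2 * π * I * (affinePoint h.left_pos h.right_pos b τ / 4))) *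
        cexp (2 * π * I * (b / (4 * d))) = 1 := by
  have hN' : (N : ℂ) ≠ 0 := mod_cast hN
  have hd : (d : ℂ) ≠ 0 := mod_cast h.right_pos.ne'
  rw [← Complex.exp_add, ← Complex.exp_add, ← Complex.exp_zero, coe_affinePoint, ← h.mul_eq]
  congr 1
  push_cast
  field_simp
  ring

lemma IsScaleFactorization.hasJacobiExpansion_starForm (h : IsScaleFactorization m g g' a d b)
    (hm : m ≠ 0) (hN : N ≠ 0) {k : ℤ} (hf : f ∈ modularForms (k - 1) (m * N)
      (twistedNebentypus m χ)) :
    HasJacobiExpansion m (m * N) (jacobiSlash k m g (starForm m f)) := by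
  have hφ (γ : Gamma0 (m * N)) (τ : ℍ) := (starForm_transform_iff hm k γ τ).2 (hf.2.1 γ τ)
  obtain ⟨n, c, hc, hG⟩ := exists_hasSum_of_isBoundedAtImInfty (mul_ne_zero hm hN)
    (f := f ∣[(k - 1)] g) (hf.1.slash (k - 1) _) (hf.2.2 g) (h.slash_vadd_mul hφ)
  have hzero := h.hasJacobiExpansion_mul hN hc hG
    (κ := fun p ↦ p.1 ^ 2 + (p.2 ^ 2 + p.2)) (ρ := fun p ↦ 2 * p.1)
    (fun p ↦ by nlinarith [sq_nonneg (2 * p.2 + 1)])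
    fun w hw z ↦ by simpa using hasSum_thetaJ_mul_thetaJ hw z 0
  have hone := h.hasJacobiExpansion_mul hN hc hG
    (κ := fun p ↦ p.1 ^ 2 + (p.2 ^ 2 + p.2)) (ρ := fun p ↦ 2 * p.2 + 1)
    (fun p ↦ by nlinarith [sq_nonneg p.1])
    fun w hw z ↦ by simpa using hasSum_thetaJ_mul_thetaJ hw 0 z
  convert (hzero.sub hone).const_smul
    ((thetaMultiplier 1 g').det / d * cexp (2 * π * I * (b / (4 * d)))) using 1
  ext τ z
  rw [h.jacobiSlash_starForm]
  simp only [Pi.smul_apply, Pi.sub_apply, smul_eq_mul, thetaWedge, theta]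
  set w := (affinePoint h.left_pos h.right_pos b τ : ℂ)
  linear_combination (-((thetaMultiplier 1 g').det / d * (f ∣[(k - 1)] g) τ *
    (thetaJ 1 1 w 0 * thetaJ 1 0 w (a * z) - thetaJ 1 0 w 0 * thetaJ 1 1 w (a * z)))) *
      h.cexp_mul_cexp_neg_affinePoint hN τ

lemma isJointlyHolomorphic_starForm (hm : m ≠ 0) (hf : MDiff f) :
    IsJointlyHolomorphic (starForm m f) := by
  have hf' : DifferentiableOn ℂ (fun p : ℂ × ℂ ↦ f (ofComplex p.1)) {p | 0 < p.1.im} :=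
    (UpperHalfPlane.mdifferentiable_iff.1 hf).comp (f := fun p : ℂ × ℂ ↦ p.1) (by fun_prop)
      fun p hp ↦ hp
  have hJ (r : ℕ) := differentiableOn_thetaJ hm r
  have hθ (r : ℕ) : DifferentiableOn ℂ (fun p : ℂ × ℂ ↦ theta m r p.1) {p | 0 < p.1.im} :=
    (hJ r).comp (f := fun p : ℂ × ℂ ↦ (p.1, (0 : ℂ))) (by fun_prop) fun p hp ↦ hp
  refine (hf'.mul (((hθ m).mul (hJ 0)).sub ((hθ 0).mul (hJ m)))).congr fun p hp ↦ ?_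
  simp [starForm, thetaWedge_mul hm, ofComplex_apply_of_im_pos hp]

lemma starForm_add_lattice (hm : m ≠ 0) (l μ : ℤ) (τ : ℍ) (z : ℂ) :
    starForm m f τ (z + l * τ + μ) =
      cexp (-(2 * π * I * m * ((l : ℂ) ^ 2 * τ + 2 * l * z))) * starForm m f τ z := by
  simp only [starForm, thetaWedge_mul hm, thetaJ_add_lattice hm]
  ring

theorem starForm_mem_jacobiStarKernel (hm : m ≠ 0) (hN : N ≠ 0) {k : ℤ}
    (hf : f ∈ modularForms (k - 1) (m * N) (twistedNebentypus m χ)) :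
    starForm m f ∈ jacobiStarKernel k m N χ := by
  refine ⟨⟨isJointlyHolomorphic_starForm hm hf.1,
    fun γ τ ↦ (starForm_transform_iff hm k γ τ).2 (hf.2.1 γ τ), starForm_add_lattice hm,
    fun g ↦ ?_⟩, ⟨_, isThetaDecomposition_starForm hm f, fun r _ h₀ hr ↦ ?_⟩, starForm_zero m f⟩
  · obtain ⟨g', a, d, b, h⟩ := exists_isScaleFactorization hm g
    exact h.hasJacobiExpansion_starForm hm hN hf
  · ext τ
    simp [h₀, hr]

end

/-! ### The isomorphisms -/

section

variable {k m N : ℕ}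

/-- The operator `D₂` as a linear map from Jacobi forms to cusp forms. -/
def D₂Linear (k : ℕ) {m M : ℕ} (hm : m ≠ 0) (hM : M ≠ 0) (χ : DirichletCharacter ℂ M) :
    jacobiForms k m M χ →ₗ[ℂ] cuspForms (k + 2) M (nebentypus χ) where
  toFun φ := ⟨D₂ k m φ, D₂_mem_cuspForms hm hM φ.2⟩
  map_add' φ ψ := Subtype.ext (heatOperator_add k (2 * m) φ.2.1 ψ.2.1)
  map_smul' c φ := Subtype.ext (heatOperator_smul k (2 * m) c φ)

lemma heatOperator_eq_D₂ {χ : DirichletCharacter ℂ (m * N)} {φ : ℍ → ℂ → ℂ}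
    (hφ : φ ∈ jacobiStarKernel k m N χ) (a : ℂ) : heatOperator k a φ = D₂ k m φ := by
  ext τ
  rw [D₂, heatOperator_of_apply_zero _ _ hφ.2.2, heatOperator_of_apply_zero _ _ hφ.2.2]

/-- Multiplication by `θ_{m,m} θ^J_{m,0} - θ_{m,0} θ^J_{m,m}` as a linear map. -/
def starFormLinear (k : ℕ) (hm : m ≠ 0) (hN : N ≠ 0) (χ : DirichletCharacter ℂ (m * N)) :
    modularForms (k - 1) (m * N) (twistedNebentypus m χ) →ₗ[ℂ] jacobiStarKernel k m N χ where
  toFun f := ⟨starForm m f, starForm_mem_jacobiStarKernel hm hN f.2⟩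
  map_add' _ _ := Subtype.ext <| funext₂ fun _ _ ↦ add_mul _ _ _
  map_smul' _ _ := Subtype.ext <| funext₂ fun _ _ ↦ mul_assoc _ _ _

lemma starFormLinear_bijective (hk : k ≠ 0) (hm : m ≠ 0) (hN : N ≠ 0)
    (χ : DirichletCharacter ℂ (m * N)) : Function.Bijective (starFormLinear k hm hN χ) := by
  refine ⟨fun f g h ↦ Subtype.ext (starForm_injective hm (congrArg Subtype.val h)), fun φ ↦ ?_⟩
  obtain ⟨f, hf⟩ := exists_eq_starForm hm φ.2
  exact ⟨⟨f, mem_modularForms_of_starForm_mem hk hm hN (hf ▸ φ.2.1)⟩, Subtype.ext hf.symm⟩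

/-- Multiplication by `θ_{m,m} θ^J_{m,0} - θ_{m,0} θ^J_{m,m}` as a linear isomorphism: the inverse
of `Λ*_m`. -/
def starFormEquiv (hk : k ≠ 0) (hm : m ≠ 0) (hN : N ≠ 0) (χ : DirichletCharacter ℂ (m * N)) :
    modularForms (k - 1) (m * N) (twistedNebentypus m χ) ≃ₗ[ℂ] jacobiStarKernel k m N χ :=
  LinearEquiv.ofBijective (starFormLinear k hm hN χ) (starFormLinear_bijective hk hm hN χ)

lemma starFormEquiv_symm_apply (hk : k ≠ 0) (hm : m ≠ 0) (hN : N ≠ 0)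
    {χ : DirichletCharacter ℂ (m * N)} (φ : jacobiStarKernel k m N χ) {h : ℕ → ℍ → ℂ}
    (hh : IsThetaDecomposition m φ h) (τ : ℍ) :
    ((starFormEquiv hk hm hN χ).symm φ : ℍ → ℂ) τ = h 0 τ / theta m m τ ∧
      ((starFormEquiv hk hm hN χ).symm φ : ℍ → ℂ) τ = -h m τ / theta m 0 τ := by
  obtain ⟨f, rfl⟩ := (starFormEquiv hk hm hN χ).surjective φ
  have hf := isThetaDecomposition_starForm hm (f : ℍ → ℂ)
  rw [LinearEquiv.symm_apply_apply, hh.eq hm hf (j := 0) (by omega),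
    hh.eq hm hf (j := m) (by omega)]
  simp [hm, theta_self_ne_zero hm, theta_zero_ne_zero hm]

lemma mul_xiStar_mul_mem_cuspStar (hm : m ≠ 0) (hN : N ≠ 0) {χ : DirichletCharacter ℂ (m * N)}
    {f : ℍ → ℂ} (hf : f ∈ modularForms (k - 1) (m * N) (twistedNebentypus m χ)) :
    (fun τ ↦ 4 * m * k * xiStar m τ * f τ) ∈ cuspStar k m N χ := by
  constructor
  · rw [← funext (D₂_starForm k hm f)]
    exact D₂_mem_cuspForms hm (mul_ne_zero hm hN) (starForm_mem_jacobiStarKernel hm hN hf).1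
  · convert Submodule.smul_mem _ (4 * m * k : ℂ) hf using 1
    ext τ
    simp only [Pi.div_apply, Pi.smul_apply, smul_eq_mul]
    field_simp [xiStar_ne_zero hm τ]

/-- Multiplication by `4 m k ξ*_m` as a linear map. -/
def mulXiStarLinear (k : ℕ) (hm : m ≠ 0) (hN : N ≠ 0) (χ : DirichletCharacter ℂ (m * N)) :
    modularForms (k - 1) (m * N) (twistedNebentypus m χ) →ₗ[ℂ] cuspStar k m N χ where
  toFun f := ⟨_, mul_xiStar_mul_mem_cuspStar hm hN f.2⟩
  map_add' _ _ := Subtype.ext <| funext fun _ ↦ mul_add _ _ _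
  map_smul' _ _ := Subtype.ext <| funext fun _ ↦ mul_left_comm _ _ _

lemma mulXiStarLinear_bijective (hk : k ≠ 0) (hm : m ≠ 0) (hN : N ≠ 0)
    (χ : DirichletCharacter ℂ (m * N)) : Function.Bijective (mulXiStarLinear k hm hN χ) := by
  have hc (τ : ℍ) : (4 * m * k * xiStar m τ : ℂ) ≠ 0 := by simp [hk, hm, xiStar_ne_zero hm]
  refine ⟨fun f g h ↦ ?_, fun g ↦
    ⟨⟨(4 * m * k : ℂ)⁻¹ • ((g : ℍ → ℂ) / xiStar m), Submodule.smul_mem _ _ g.2.2⟩, ?_⟩⟩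
  · ext τ
    exact mul_left_cancel₀ (hc τ) (congrFun (congrArg Subtype.val h) τ)
  · ext τ
    change 4 * m * k * xiStar m τ * ((4 * m * k : ℂ)⁻¹ * ((g : ℍ → ℂ) τ / xiStar m τ)) = _
    rw [← div_eq_inv_mul, div_div, mul_comm (xiStar m τ), mul_div_cancel₀ _ (hc τ)]

/-- Multiplication by `4 m k ξ*_m` as a linear isomorphism. -/
def mulXiStarEquiv (hk : k ≠ 0) (hm : m ≠ 0) (hN : N ≠ 0) (χ : DirichletCharacter ℂ (m * N)) :
    modularForms (k - 1) (m * N) (twistedNebentypus m χ) ≃ₗ[ℂ] cuspStar k m N χ :=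
  LinearEquiv.ofBijective (mulXiStarLinear k hm hN χ) (mulXiStarLinear_bijective hk hm hN χ)

lemma mulXiStarEquiv_starFormEquiv_symm (hk : k ≠ 0) (hm : m ≠ 0) (hN : N ≠ 0)
    {χ : DirichletCharacter ℂ (m * N)} (φ : jacobiStarKernel k m N χ) :
    (mulXiStarEquiv hk hm hN χ ((starFormEquiv hk hm hN χ).symm φ) : ℍ → ℂ) = D₂ k m φ := by
  obtain ⟨f, rfl⟩ := (starFormEquiv hk hm hN χ).surjective φ
  rw [LinearEquiv.symm_apply_apply]
  exact (funext (D₂_starForm k hm (f : ℍ → ℂ))).symm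

end

end JacobiRestriction

end

theorem theorem4p2_general (k m N : ℕ) (hk : 0 < k) (hm : m ≠ 0) (hN : 0 < N)
    (χ : DirichletCharacter ℂ (m * N)) :
    (∀ τ : ℍ, xiStar m τ = -(π * I * m * ModularForm.eta (m * (τ : ℂ)) ^ 6)) ∧
    (∃ D : jacobiForms k m (m * N) χ →ₗ[ℂ] cuspForms (k + 2) (m * N) (nebentypus χ),
      ∀ φ, (D φ : ℍ → ℂ) = D₂ k m φ) ∧
    (∀ φ ∈ jacobiStarKernel k m N χ, ∀ a : ℂ, heatOperator k a φ = D₂ k m φ) ∧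
    ∃ (Λ : jacobiStarKernel k m N χ ≃ₗ[ℂ]
          modularForms (k - 1) (m * N) (twistedNebentypus m χ))
      (E : jacobiStarKernel k m N χ ≃ₗ[ℂ] cuspStar k m N χ)
      (B : modularForms (k - 1) (m * N) (twistedNebentypus m χ) ≃ₗ[ℂ] cuspStar k m N χ),
      (∀ φ, (E φ : ℍ → ℂ) = D₂ k m φ) ∧
      (∀ (φ : jacobiStarKernel k m N χ) (h : ℕ → ℍ → ℂ), IsThetaDecomposition m φ h →
        ∀ τ : ℍ, (Λ φ : ℍ → ℂ) τ = h 0 τ / theta m m τ ∧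
          (Λ φ : ℍ → ℂ) τ = -h m τ / theta m 0 τ) ∧
      (∀ (f : modularForms (k - 1) (m * N) (twistedNebentypus m χ)) (τ : ℍ),
        (B f : ℍ → ℂ) τ = 4 * m * k * xiStar m τ * (f : ℍ → ℂ) τ) ∧
      ∀ φ, B (Λ φ) = E φ := by
  have hk' := hk.ne'
  have hN' := hN.ne'
  let Λ := (starFormEquiv hk' hm hN' χ).symm
  let B := mulXiStarEquiv hk' hm hN' χ
  exact ⟨xiStar_eq hm, ⟨D₂Linear k hm (mul_ne_zero hm hN') χ, fun _ ↦ rfl⟩,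
    fun _ hφ a ↦ heatOperator_eq_D₂ hφ a, Λ, Λ.trans B, B,
    mulXiStarEquiv_starFormEquiv_symm hk' hm hN',
    fun φ _ hh τ ↦ starFormEquiv_symm_apply hk' hm hN' φ hh τ, fun _ _ ↦ rfl, fun _ ↦ rfl⟩

theorem theorem4p2 (k m N : ℕ) (hk : 0 < k) (hm : Squarefree m) (hN : 0 < N)
    (χ : DirichletCharacter ℂ (m * N)) :
    (∀ τ : ℍ, xiStar m τ = -(π * I * m * ModularForm.eta (m * (τ : ℂ)) ^ 6)) ∧
    (∃ D : jacobiForms k m (m * N) χ →ₗ[ℂ] cuspForms (k + 2) (m * N) (nebentypus χ),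
      ∀ φ, (D φ : ℍ → ℂ) = D₂ k m φ) ∧
    (∀ φ ∈ jacobiStarKernel k m N χ, ∀ a : ℂ, heatOperator k a φ = D₂ k m φ) ∧
    ∃ (Λ : jacobiStarKernel k m N χ ≃ₗ[ℂ]
          modularForms (k - 1) (m * N) (twistedNebentypus m χ))
      (E : jacobiStarKernel k m N χ ≃ₗ[ℂ] cuspStar k m N χ)
      (B : modularForms (k - 1) (m * N) (twistedNebentypus m χ) ≃ₗ[ℂ] cuspStar k m N χ),
      (∀ φ, (E φ : ℍ → ℂ) = D₂ k m φ) ∧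
      (∀ (φ : jacobiStarKernel k m N χ) (h : ℕ → ℍ → ℂ), IsThetaDecomposition m φ h →
        ∀ τ : ℍ, (Λ φ : ℍ → ℂ) τ = h 0 τ / theta m m τ ∧
          (Λ φ : ℍ → ℂ) τ = -h m τ / theta m 0 τ) ∧
      (∀ (f : modularForms (k - 1) (m * N) (twistedNebentypus m χ)) (τ : ℍ),
        (B f : ℍ → ℂ) τ = 4 * m * k * xiStar m τ * (f : ℍ → ℂ) τ) ∧
      ∀ φ, B (Λ φ) = E φ :=
  theorem4p2_general k m N hk hm.ne_zero hN χ
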